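/- Let $x=(x_1,x_2,\ldots)$ be infinitely many indeterminates, let $p_k=\sum_{i\ge1}x_i^k$ for $k\ge1$, and put $p_\nu=p_{\nu_1}p_{\nu_2}\cdots$ for a partition $\nu$ (with $p_\emptyset=1$); the degree of the term $p_\nu$ is defined to be the length $\ell(\nu)$, i.e. the number of its parts. Define $q_k$ by $$\prod_{i\ge1}\frac{1+x_it}{1-x_it}=\sum_{k\ge0}q_k t^k ,$$ put $Q_{(a,b)}=q_aq_b+2\sum_{m=1}^{b}(-1)^mq_{a+m}q_{b-m}$, and for a strict partition $\lambda=(\lambda_1>\cdots>\lambda_\ell>0)$ define Schur's $Q$-function $Q_\lambda$ by $Q_\emptyset=1$ and the recurrences $$Q_{(\lambda_1,\ldots,\lambda_{2k+1})}=\sum_{m=1}^{2k+1}(-1)^{m+1}q_{\lambda_m}Q_{(\lambda_1,\ldots,\widehat{\lambda_m},\ldots,\lambda_{2k+1})},$$ $$Q_{(\lambda_1,\ldots,\lambda_{2k})}=\sum_{m=2}^{2k}(-1)^{m}Q_{(\lambda_1,\lambda_m)}Q_{(\lambda_2,\ldots,\widehat{\lambda_m},\ldots,\lambda_{2k})}\qquad(k\ge1).$$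 The shifted diagram of $\lambda$ is obtained from its Young diagram by moving the $i$-th row $i-1$ squares to the right. A bar tableau of shape $\lambda$ is a filling of the shifted diagram with positive integers such that (1) every row is weakly increasing; (2) every integer that occurs occurs an odd number of times; (3) every integer occurs in at most two rows, and if it occurs in two rows, then both of these rows begin with it; (4) for every $k$, after removing all squares with entries larger than $k$, the nonzero row lengths that remain are distinct. The squares with a given entry form one bar, so the number of bars is the number of distinct entries. Let $\mathrm{srank}(\lambda)$ be the smallest number of bars of a bar tableau of shape $\lambda$ (such tableaux exist). Theorem. For every strict partition $\lambda$, the function $Q_\lambda$ has a unique expansion $Q_\lambda=\sum_\nu c_\nu p_\nu$ as a finite linear combination with rational coefficients of the power sums $p_\nu$, and $$\min\{\ell(\nu): c_\nu\neq0\}=\mathrm{srank}(\lambda).$$ -/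

import Mathlib

noncomputable section

/-! ### Symmetric functions in infinitely many variables

Symmetric functions are formal power series over `ℚ` in the variables `x₀, x₁, x₂, …`.
Infinite sums and products are those of coefficientwise convergence. -/

section SymmetricFunctions

open scoped MvPowerSeries.WithPiTopology PowerSeries.WithPiTopology

/-- The power sum `p_k = ∑ᵢ xᵢ ^ k`, `k ≥ 1`. -/
def powerSum (k : ℕ+) : MvPowerSeries ℕ ℚ :=
  ∑' i : ℕ, (MvPowerSeries.X i : MvPowerSeries ℕ ℚ) ^ (k : ℕ)

/-- The factor `(1 + xᵢ t) / (1 - xᵢ t)`, a power series in `t`. -/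
def qFactor (i : ℕ) : PowerSeries (MvPowerSeries ℕ ℚ) :=
  (1 + PowerSeries.C (MvPowerSeries.X i) * PowerSeries.X) *
    PowerSeries.invOfUnit (1 - PowerSeries.C (MvPowerSeries.X i) * PowerSeries.X) 1

/-- The generating function `∏ᵢ (1 + xᵢ t) / (1 - xᵢ t)`, a power series in `t`. -/
def qSeries : PowerSeries (MvPowerSeries ℕ ℚ) := ∏' i : ℕ, qFactor i

/-- `q_k`, the coefficient of `t ^ k` in `∏ᵢ (1 + xᵢ t) / (1 - xᵢ t)`. -/
def qFun (k : ℕ) : MvPowerSeries ℕ ℚ := PowerSeries.coeff k qSeries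

theorem coeff_X_pow_eq (i : ℕ) (k : ℕ+) (d : ℕ →₀ ℕ) :
    MvPowerSeries.coeff d ((MvPowerSeries.X i : MvPowerSeries ℕ ℚ) ^ (k : ℕ)) =
      if d = Finsupp.single i (k : ℕ) then 1 else 0 := by
  classical
  rw [MvPowerSeries.coeff_X_pow]

theorem summable_powerSum (k : ℕ+) :
    Summable fun i : ℕ => (MvPowerSeries.X i : MvPowerSeries ℕ ℚ) ^ (k : ℕ) := by
  rw [MvPowerSeries.WithPiTopology.summable_iff_summable_coeff]
  intro d
  refine summable_of_ne_finset_zero (s := d.support) ?_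
  intro i hi
  rw [coeff_X_pow_eq, if_neg]
  rintro rfl
  exact hi (by simp)

theorem qFactor_eq (i : ℕ) :
    qFactor i = PowerSeries.mk fun n =>
      (if n = 0 then 1 else 2) * (MvPowerSeries.X i : MvPowerSeries ℕ ℚ) ^ n := by
  have hinv : PowerSeries.invOfUnit
      (1 - PowerSeries.C (MvPowerSeries.X i : MvPowerSeries ℕ ℚ) * PowerSeries.X) 1 =
      PowerSeries.mk fun n => (MvPowerSeries.X i : MvPowerSeries ℕ ℚ) ^ n := by
    have h1 := PowerSeries.mul_invOfUnit
      (1 - PowerSeries.C (MvPowerSeries.X i : MvPowerSeries ℕ ℚ) * PowerSeries.X) 1 (by simp)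
    have h2 : (PowerSeries.mk fun n => (MvPowerSeries.X i : MvPowerSeries ℕ ℚ) ^ n) *
        (1 - PowerSeries.C (MvPowerSeries.X i : MvPowerSeries ℕ ℚ) * PowerSeries.X) = 1 := by
      ext1 n
      rw [mul_sub, mul_one, mul_left_comm]
      cases n with
      | zero => simp
      | succ n =>
        rw [map_sub, PowerSeries.coeff_C_mul, PowerSeries.coeff_succ_mul_X]
        simp [pow_succ', PowerSeries.coeff_one]
    exact (left_inv_eq_right_inv h2 h1).symm
  rw [qFactor, hinv]
  ext1 n
  rw [add_mul, one_mul, mul_assoc, mul_comm PowerSeries.X]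
  cases n with
  | zero => simp
  | succ n =>
    rw [map_add, PowerSeries.coeff_C_mul, PowerSeries.coeff_succ_mul_X]
    simp only [PowerSeries.coeff_mk, Nat.succ_ne_zero, if_false]
    ring

theorem coeff_prod_qFactor (s : Finset ℕ) (k : ℕ) (d : ℕ →₀ ℕ) :
    MvPowerSeries.coeff d (PowerSeries.coeff k (∏ i ∈ s, qFactor i)) =
      if d.support ⊆ s ∧ d.degree = k then (2 : ℚ) ^ d.support.card else 0 := by
  classical
  induction s using Finset.induction_on generalizing k d with
  | empty =>
    rw [Finset.prod_empty, PowerSeries.coeff_one]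
    by_cases hk : k = 0
    · subst hk
      rw [if_pos rfl, MvPowerSeries.coeff_one]
      by_cases hd : d = 0
      · simp [hd]
      · simp [hd]
    · rw [if_neg hk, map_zero, if_neg]
      rintro ⟨h1, h2⟩
      have : d = 0 := by simpa using h1
      subst this
      exact hk (by simpa using h2.symm)
  | insert i s hi ih =>
    have hterm : ∀ a b : ℕ, MvPowerSeries.coeff d
        (PowerSeries.coeff a (qFactor i) * PowerSeries.coeff b (∏ i ∈ s, qFactor i)) =
        if a = d i then (if a = 0 then 1 else 2) *
          (if (d.erase i).support ⊆ s ∧ (d.erase i).degree = b then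
            (2 : ℚ) ^ (d.erase i).support.card else 0) else 0 := by
      intro a b
      have hc : ((if a = 0 then 1 else 2 : MvPowerSeries ℕ ℚ)) *
          (MvPowerSeries.X i : MvPowerSeries ℕ ℚ) ^ a =
          MvPowerSeries.monomial (Finsupp.single i a) (if a = 0 then 1 else 2 : ℚ) := by
        rw [MvPowerSeries.X_pow_eq]
        split_ifs
        · rw [one_mul]
        · rw [two_mul, ← map_add]; norm_num
      rw [qFactor_eq, PowerSeries.coeff_mk, hc, MvPowerSeries.coeff_monomial_mul, ih]
      by_cases ha : a = d i
      · have hle : Finsupp.single i a ≤ d := by simp [ha]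
        have he : d - Finsupp.single i a = d.erase i := by
          ext j
          by_cases hj : j = i
          · subst hj; simp [ha]
          · simp [Finsupp.erase_ne hj, Ne.symm hj]
        rw [if_pos hle, if_pos ha, he]
      · rw [if_neg ha]
        by_cases hle : Finsupp.single i a ≤ d
        · rw [if_pos hle]
          refine mul_eq_zero_of_right _ (if_neg ?_)
          rintro ⟨h1, -⟩
          refine hi (h1 ?_)
          have hlt : a ≤ d i := by simpa using hle
          simp only [Finsupp.mem_support_iff, Finsupp.coe_tsub, Pi.sub_apply,
            Finsupp.single_eq_same]
          omega
        · rw [if_neg hle]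
    have hdeg : d.degree = d i + (d.erase i).degree := by
      conv_lhs => rw [← Finsupp.single_add_erase i d]
      rw [map_add, Finsupp.degree_single]
    rw [Finset.prod_insert hi, PowerSeries.coeff_mul, map_sum]
    simp only [hterm]
    have hsub : (d.erase i).support ⊆ s ↔ d.support ⊆ insert i s := by
      rw [Finsupp.support_erase, Finset.subset_insert_iff]
    by_cases hk : d i ≤ k
    · rw [Finset.sum_eq_single (d i, k - d i)]
      · have hiff : (d.erase i).degree = k - d i ↔ d.degree = k := by omega
        simp only [if_true, hsub, hiff]
        by_cases hcond : d.support ⊆ insert i s ∧ d.degree = k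
        · rw [if_pos hcond, if_pos hcond, Finsupp.support_erase]
          by_cases h0 : d i = 0
          · rw [if_pos h0, one_mul, Finset.erase_eq_of_notMem (by simpa using h0)]
          · rw [if_neg h0, ← pow_succ', Finset.card_erase_add_one (by simpa using h0)]
        · rw [if_neg hcond, if_neg hcond, mul_zero]
      · rintro ⟨a, b⟩ hab hne
        rw [if_neg]
        rintro rfl
        apply hne
        rw [Finset.HasAntidiagonal.mem_antidiagonal] at hab
        dsimp only at hab
        rw [← hab, Nat.add_sub_cancel_left]
      · intro h
        exact absurd (by simp [hk]) h
    · rw [Finset.sum_eq_zero, if_neg]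
      · rintro ⟨-, h⟩
        omega
      · rintro ⟨a, b⟩ hab
        rw [if_neg]
        rintro rfl
        rw [Finset.HasAntidiagonal.mem_antidiagonal] at hab
        dsimp only at hab
        omega

theorem exists_coeff_eq (g : (ℕ →₀ ℕ) → ℚ) :
    ∃ f : MvPowerSeries ℕ ℚ, ∀ d, MvPowerSeries.coeff d f = g d := ⟨g, fun _ => rfl⟩

/-- The infinite product converges, and its coefficients are the expected ones. -/
theorem exists_hasProd_qFactor : ∃ f : ℕ → MvPowerSeries ℕ ℚ,
    (∀ k d, MvPowerSeries.coeff d (f k) =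
      if d.degree = k then (2 : ℚ) ^ d.support.card else 0) ∧
    HasProd qFactor (PowerSeries.mk f) := by
  choose f hf using fun k : ℕ => exists_coeff_eq fun d =>
    if d.degree = k then (2 : ℚ) ^ d.support.card else 0
  refine ⟨f, hf, ?_⟩
  rw [HasProd, PowerSeries.WithPiTopology.tendsto_iff_coeff_tendsto]
  intro k
  rw [MvPowerSeries.WithPiTopology.tendsto_iff_coeff_tendsto]
  intro d
  refine tendsto_const_nhds.congr' ?_
  rw [SummationFilter.unconditional_filter]
  filter_upwards [Filter.eventually_ge_atTop d.support] with s hs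
  rw [coeff_prod_qFactor, PowerSeries.coeff_mk, hf]
  have : d.support ⊆ s := hs
  simp only [this, true_and]

theorem hasProd_qFactor : HasProd qFactor qSeries := by
  obtain ⟨f, -, h⟩ := exists_hasProd_qFactor
  rw [qSeries, h.tprod_eq]
  exact h

theorem coeff_qFun (k : ℕ) (d : ℕ →₀ ℕ) :
    MvPowerSeries.coeff d (qFun k) = if d.degree = k then (2 : ℚ) ^ d.support.card else 0 := by
  obtain ⟨f, hf, h⟩ := exists_hasProd_qFactor
  rw [qFun, qSeries, h.tprod_eq, PowerSeries.coeff_mk, hf]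

end SymmetricFunctions

/-! ### Schur's `Q`-functions -/

/-- `Q_{(a,b)} = q_a q_b + 2 ∑_{m=1}^{b} (-1)^m q_{a+m} q_{b-m}`. -/
def schurQTwo (a b : ℕ) : MvPowerSeries ℕ ℚ :=
  qFun a * qFun b + 2 * ∑ m ∈ Finset.Icc 1 b, (-1) ^ m * (qFun (a + m) * qFun (b - m))

/-- Schur's `Q`-function `Q_lam`, by the recurrences in the length of `lam` (with `Q_∅ = 1`).
List positions are counted from `0`. -/
def schurQ : List ℕ → MvPowerSeries ℕ ℚ
  | [] => 1
  | a :: t =>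
    if Odd (a :: t).length then
      ∑ m : Fin (a :: t).length,
        (-1) ^ (m : ℕ) * (qFun ((a :: t).get m) * schurQ ((a :: t).eraseIdx m))
    else
      ∑ m : Fin t.length,
        (-1) ^ (m : ℕ) * (schurQTwo a (t.get m) * schurQ (t.eraseIdx m))
termination_by l => l.length
decreasing_by
  · have := m.isLt
    rw [List.length_eraseIdx_of_lt m.isLt]
    simp
  · have := m.isLt
    rw [List.length_eraseIdx_of_lt m.isLt]
    simp only [List.length_cons]
    omega

/-! ### The power sum expansion

A polynomial `F` in indeterminates indexed by `k = 1, 2, 3, …` stands for a finite linear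
combination of the `p_ν`: the exponent vector `m` of a monomial is the partition
`ν = ⟨1^{m₁} 2^{m₂} ⋯⟩`, the monomial stands for `p_ν = ∏ₖ p_k ^ {m_k}`, and its degree
`∑ₖ m_k` is the length of `ν`. -/

/-- `F` is a power sum expansion of `f`: putting `p_k` for the `k`-th indeterminate of `F`
yields `f`. -/
def IsPowerSumExpansion (F : MvPolynomial ℕ+ ℚ) (f : MvPowerSeries ℕ ℚ) : Prop :=
  MvPolynomial.aeval powerSum F = f

/-! ### Bar tableaux and the shifted rank -/

/-- The shifted diagram of `lam`: row `i` (from `0`) has the squares `(i, i), …,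
(i, i + lam i - 1)`. -/
def shiftedDiagram (lam : List ℕ) : Finset (ℕ × ℕ) :=
  Finset.univ.biUnion fun i : Fin lam.length =>
    {(i : ℕ)} ×ˢ Finset.Ico (i : ℕ) ((i : ℕ) + lam.get i)

/-- A bar tableau of shape `lam`: a filling of the shifted diagram with positive integers
(and, by convention, with `0` outside of it). -/
structure BarTableau (lam : List ℕ) where
  /-- The entry in a square. -/
  entry : ℕ × ℕ → ℕ
  entry_pos : ∀ c ∈ shiftedDiagram lam, 0 < entry c
  entry_eq_zero : ∀ c ∉ shiftedDiagram lam, entry c = 0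
  /-- The rows are weakly increasing. -/
  row_weak : ∀ i j₁ j₂, j₁ ≤ j₂ → (i, j₁) ∈ shiftedDiagram lam → (i, j₂) ∈ shiftedDiagram lam →
    entry (i, j₁) ≤ entry (i, j₂)
  /-- Every integer that occurs in the tableau occurs an odd number of times. -/
  odd_count : ∀ c ∈ shiftedDiagram lam,
    Odd ((shiftedDiagram lam).filter fun c' => entry c' = entry c).card
  /-- Every positive integer occurs in at most two rows. -/
  rows_le_two : ∀ k, 0 < k →
    (((shiftedDiagram lam).filter fun c => entry c = k).image Prod.fst).card ≤ 2
  /-- If a positive integer occurs in two rows, then both of these rows begin with it. -/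
  begin_of_two_rows : ∀ k, 0 < k → ∀ c ∈ shiftedDiagram lam, ∀ c' ∈ shiftedDiagram lam,
    entry c = k → entry c' = k → c.1 ≠ c'.1 → entry (c.1, c.1) = k ∧ entry (c'.1, c'.1) = k
  /-- Removing all squares with entries larger than `k` leaves rows whose nonzero lengths are
  distinct. -/
  distinct_rows : ∀ k i i', i ≠ i' →
    ((shiftedDiagram lam).filter fun c => c.1 = i ∧ entry c ≤ k).card ≠ 0 →
    ((shiftedDiagram lam).filter fun c => c.1 = i ∧ entry c ≤ k).card ≠
      ((shiftedDiagram lam).filter fun c => c.1 = i' ∧ entry c ≤ k).card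

/-- The number of bars of a bar tableau. The squares with a given entry form one bar, so this
is the number of distinct entries. -/
def BarTableau.numBars {lam : List ℕ} (T : BarTableau lam) : ℕ :=
  ((shiftedDiagram lam).image T.entry).card

/-- The shifted rank of `lam`: the number of bars in a minimal bar tableau of shape `lam`. -/
def srank (lam : List ℕ) : ℕ :=
  sInf {b | ∃ T : BarTableau lam, T.numBars = b}

theorem mem_shiftedDiagram (lam : List ℕ) (i j : ℕ) :
    (i, j) ∈ shiftedDiagram lam ↔ ∃ h : i < lam.length, i ≤ j ∧ j < i + lam[i] := by
  simp only [shiftedDiagram, Finset.mem_biUnion, Finset.mem_univ, true_and, Finset.mem_product,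
    Finset.mem_singleton, Finset.mem_Ico]
  constructor
  · rintro ⟨⟨i', hi'⟩, rfl, h⟩
    exact ⟨hi', h⟩
  · rintro ⟨h, h'⟩
    exact ⟨⟨i, h⟩, rfl, h'⟩

/-- A strict partition has a bar tableau, so that `srank` is a minimum. -/
theorem exists_barTableau (lam : List ℕ) (hstrict : lam.Pairwise (· > ·)) :
    Nonempty (BarTableau lam) := by
  classical
  -- Rows are filled one after the other with increasing distinct numbers.
  let D := shiftedDiagram lam
  let M := D.sup Prod.snd + 1
  have hM : ∀ c ∈ D, c.2 < M := fun c hc => Nat.lt_succ_of_le (Finset.le_sup (f := Prod.snd) hc)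
  let e : ℕ × ℕ → ℕ := fun c => if c ∈ D then c.1 * M + c.2 + 1 else 0
  have he : ∀ c ∈ D, e c = c.1 * M + c.2 + 1 := fun c hc => if_pos hc
  have hlt : ∀ c ∈ D, ∀ c' ∈ D, c.1 < c'.1 → e c < e c' := by
    intro c hc c' hc' h
    rw [he c hc, he c' hc']
    have h1 := hM c hc
    have h2 : (c.1 + 1) * M ≤ c'.1 * M := Nat.mul_le_mul_right M h
    rw [Nat.add_mul] at h2
    omega
  have hinj : ∀ c ∈ D, ∀ c' ∈ D, e c = e c' → c = c' := by
    intro c hc c' hc' h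
    rcases lt_trichotomy c.1 c'.1 with h1 | h1 | h1
    · have := hlt c hc c' hc' h1
      omega
    · rw [he c hc, he c' hc', h1] at h
      exact Prod.ext h1 (by omega)
    · have := hlt c' hc' c hc h1
      omega
  have hrow : ∀ i, (D.filter fun c => c.1 = i).card = lam.getD i 0 := by
    intro i
    have : (D.filter fun c => c.1 = i) = (Finset.Ico i (i + lam.getD i 0)).image (Prod.mk i) := by
      ext ⟨i', j⟩
      simp only [Finset.mem_filter, D, mem_shiftedDiagram, Finset.mem_image, Finset.mem_Ico,
        Prod.mk.injEq]
      constructor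
      · rintro ⟨⟨h, h1, h2⟩, rfl⟩
        exact ⟨j, by simpa [h] using ⟨h1, h2⟩, rfl, rfl⟩
      · rintro ⟨j', ⟨h1, h2⟩, rfl, rfl⟩
        by_cases h : i < lam.length
        · refine ⟨⟨h, h1, ?_⟩, rfl⟩
          simpa [h] using h2
        · simp [h] at h2
          omega
    rw [this, Finset.card_image_of_injective _ (Prod.mk_right_injective i)]
    simp
  have hdec : ∀ i i', i < i' → lam.getD i' 0 ≠ 0 → lam.getD i' 0 < lam.getD i 0 := by
    intro i i' h h0
    have h' : i' < lam.length := by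
      by_contra hc
      exact h0 (by simp [Nat.le_of_not_lt hc])
    have := List.pairwise_iff_getElem.1 hstrict i i' (h.trans h') h' h
    simpa [h', h.trans h'] using this
  have hkey : ∀ k i i', i < i' →
      (D.filter fun c => c.1 = i' ∧ e c ≤ k).card ≠ 0 →
      (D.filter fun c => c.1 = i' ∧ e c ≤ k).card < (D.filter fun c => c.1 = i ∧ e c ≤ k).card := by
    intro k i i' h h0
    have h1 : (D.filter fun c => c.1 = i' ∧ e c ≤ k).card ≤ lam.getD i' 0 := by
      rw [← hrow]
      exact Finset.card_le_card fun c hc => by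
        simp only [Finset.mem_filter] at hc ⊢
        exact ⟨hc.1, hc.2.1⟩
    have h2 : (D.filter fun c => c.1 = i ∧ e c ≤ k) = D.filter fun c => c.1 = i := by
      obtain ⟨c', hc'⟩ := Finset.card_ne_zero.1 h0
      simp only [Finset.mem_filter] at hc'
      ext c
      simp only [Finset.mem_filter]
      constructor
      · rintro ⟨a, b, -⟩
        exact ⟨a, b⟩
      · rintro ⟨a, b⟩
        refine ⟨a, b, ?_⟩
        have := hlt c a c' hc'.1 (by rw [b, hc'.2.1]; exact h)
        omega
    rw [h2, hrow]
    exact lt_of_le_of_lt h1 (hdec i i' h (by omega))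
  have hone : ∀ k, (D.filter fun c => e c = k).card ≤ 1 := fun k =>
    Finset.card_le_one.2 fun a ha b hb => by
      simp only [Finset.mem_filter] at ha hb
      exact hinj a ha.1 b hb.1 (by omega)
  refine ⟨⟨e, ?_, ?_, ?_, ?_, ?_, ?_, ?_⟩⟩
  · intro c hc
    rw [he c hc]
    omega
  · intro c hc
    exact if_neg hc
  · intro i j₁ j₂ h h1 h2
    rw [he _ h1, he _ h2]
    dsimp only
    omega
  · intro c hc
    have h1 := hone (e c)
    have h2 : 0 < (D.filter fun c' => e c' = e c).card :=
      Finset.card_pos.2 ⟨c, by simp [hc, D]⟩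
    have h3 : (D.filter fun c' => e c' = e c).card = 1 := by omega
    change Odd (D.filter fun c' => e c' = e c).card
    rw [h3]
    exact odd_one
  · intro k _
    exact (Finset.card_image_le.trans (hone k)).trans one_le_two
  · intro k _ c hc c' hc' h1 h2 hne
    exact absurd (congrArg Prod.fst (hinj c hc c' hc' (by omega))) hne
  · intro k i i' hne h0 heq
    rcases Nat.lt_or_gt_of_ne hne with h | h
    · exact absurd heq (hkey k i i' h (heq ▸ h0)).ne'
    · exact absurd heq (hkey k i' i h h0).ne

end

/-!
The power sums are algebraically independent, and differentiating `log ∏ (1 + xᵢ t) / (1 - xᵢ t)`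
gives `n qₙ = 2 ∑ pₖ qₙ₋ₖ` over odd `k`, so every `Q_λ` is a polynomial in the odd power sums. The
lengths of the terms of `Q_(a,b)` have the parity of `a + b`. After padding `λ` with a part `0` if
its length is odd, the Pfaffian recurrence makes `Q_λ` a signed sum over the perfect matchings of
the parts, in which a pair contributes length at least `1` if its entries have opposite parity and
at least `2` otherwise. Hence every term has length at least
`max (#odd parts) (#even parts + ℓ(λ) mod 2)`, and some term of this length survives cancellation:
pair the largest part with the largest part of the opposite parity and go on by induction, until
all positive parts have the same parity.

The same number is `srank λ`. To each odd row one can assign a bar having an odd number of squares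
in it, and a similar choice works for the even rows; both assignments are injective, and the parity
of the number of bars is that of `|λ|`. Joining odd rows to even rows, and the surplus even rows in
pairs, attains this bound.
-/

noncomputable section

open Finset

section AlgebraicIndependence

open MvPolynomial

section PowerSums

variable {σ R : Type*} [Fintype σ] [CommRing R] [Algebra ℚ R]

theorem esymm_mem_adjoin_psum {n k : ℕ} (hk : k ≤ n) :
    esymm σ R k ∈ Algebra.adjoin R (Set.range fun i : Fin n => psum σ R (i + 1)) := by
  induction k using Nat.strong_induction_on with
  | _ k ih =>
    set S := Algebra.adjoin R (Set.range fun i : Fin n => psum σ R (i + 1))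
    rcases k.eq_zero_or_pos with rfl | hpos
    · exact esymm_zero σ R ▸ one_mem S
    have hmul : (k : MvPolynomial σ R) * esymm σ R k ∈ S := by
      rw [mul_esymm_eq_sum]
      refine mul_mem (pow_mem (neg_mem (one_mem S)) _) (sum_mem fun a ha => ?_)
      simp only [mem_filter, HasAntidiagonal.mem_antidiagonal] at ha
      refine mul_mem (mul_mem (pow_mem (neg_mem (one_mem S)) _) (ih _ ha.2 (by omega))) ?_
      exact Algebra.subset_adjoin ⟨⟨a.2 - 1, by omega⟩, congrArg (psum σ R) (by simp; omega)⟩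
    have hinv : esymm σ R k =
        algebraMap ℚ R (k : ℚ)⁻¹ • ((k : MvPolynomial σ R) * esymm σ R k) := by
      have hk0 : (k : ℚ) ≠ 0 := by positivity
      rw [algebraMap_smul, ← nsmul_eq_mul, ← Nat.cast_smul_eq_nsmul ℚ, smul_smul,
        inv_mul_cancel₀ hk0, one_smul]
    exact hinv ▸ S.smul_mem hmul _

theorem algebraicIndependent_psum [IsDomain R] {n : ℕ} (hn : Fintype.card σ = n) :
    AlgebraicIndependent R fun i : Fin n => psum σ R (i + 1) := by
  let e := esymmAlgEquiv (R := R) σ hn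
  let φ : MvPolynomial (Fin n) R →ₐ[R] MvPolynomial σ R :=
    (symmetricSubalgebra σ R).val.comp e.toAlgHom
  have hφ : Function.Injective φ := Subtype.val_injective.comp e.injective
  let y (i : Fin n) : MvPolynomial (Fin n) R := e.symm ⟨_, psum_isSymmetric σ R (i + 1)⟩
  have hy : φ ∘ y = fun i : Fin n => psum σ R (i + 1) := by ext1; simp [φ, y]
  have hX (i : Fin n) : X i ∈ Algebra.adjoin R (Set.range y) := by
    have hesymm := esymm_mem_adjoin_psum (σ := σ) (R := R) (Nat.succ_le_of_lt i.isLt)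
    rw [← hy, Set.range_comp, ← AlgHom.map_adjoin] at hesymm
    obtain ⟨w, hw, hwi⟩ := hesymm
    have hφX : φ (X i) = esymm σ R (i + 1) := by simp [φ, e, esymmAlgEquiv_apply, esymmAlgHom]
    rwa [hφ (hwi.trans hφX.symm)] at hw
  have hadjoin : Algebra.adjoin R (Set.range y) = ⊤ := by
    rw [eq_top_iff, ← adjoin_range_X, Algebra.adjoin_le_iff, Set.range_subset_iff]
    exact hX
  have : Algebra.IsAlgebraic (Algebra.adjoin R (Set.range y)) (MvPolynomial (Fin n) R) :=
    ⟨fun p => isAlgebraic_algebraMap (⟨p, hadjoin ▸ trivial⟩ : Algebra.adjoin R (Set.range y))⟩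
  have hbasis := Algebra.IsAlgebraic.isTranscendenceBasis_of_lift_le_trdeg_of_finite R y
    (by simp [trdeg_of_isDomain])
  exact hy ▸ hbasis.1.map' hφ

end PowerSums

theorem coeff_powerSum (k : ℕ+) (d : ℕ →₀ ℕ) : MvPowerSeries.coeff d (powerSum k) =
    ∑ i ∈ d.support, if d = Finsupp.single i (k : ℕ) then 1 else 0 := by
  open scoped MvPowerSeries.WithPiTopology in
  have hcoeff := (summable_powerSum k).hasSum.map (MvPowerSeries.coeff (R := ℚ) d)
    (MvPowerSeries.WithPiTopology.continuous_coeff ℚ d)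
  simp only [Function.comp_def, coeff_X_pow_eq] at hcoeff
  refine hcoeff.unique (hasSum_sum_of_ne_finset_zero fun i hi => if_neg ?_)
  rintro rfl
  exact hi (by simp)

theorem killCompl_powerSum (n : ℕ) (k : ℕ+) :
    MvPowerSeries.killCompl (R := ℚ) (Fin.valEmbedding (n := n)) (powerSum k) =
      (psum (Fin n) ℚ k : MvPowerSeries (Fin n) ℚ) := by
  classical
  ext d
  rw [MvPowerSeries.coeff_killCompl, coeff_powerSum, coeff_coe, psum, coeff_sum,
    Finsupp.support_embDomain, sum_map]
  have hsingle (i : Fin n) : Finsupp.embDomain Fin.valEmbedding d =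
      Finsupp.single (Fin.valEmbedding i) (k : ℕ) ↔ Finsupp.single i (k : ℕ) = d := by
    rw [← Finsupp.embDomain_single, Finsupp.embDomain_inj, eq_comm]
  simp only [hsingle, coeff_X_pow]
  refine sum_subset (subset_univ _) fun i _ hi => if_neg ?_
  rintro rfl
  exact hi (by simp)

theorem algebraicIndependent_powerSum : AlgebraicIndependent ℚ powerSum := by
  refine algebraicIndependent_of_finite_type fun t ht => ?_
  obtain ⟨n, hn⟩ : ∃ n : ℕ, ∀ k ∈ t, (k : ℕ) ≤ n :=
    (ht.image ((↑) : ℕ+ → ℕ)).bddAbove.imp fun n hn k hk => hn ⟨k, hk, rfl⟩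
  have hpos (k : t) : (k : ℕ) - 1 + 1 = k := Nat.sub_add_cancel k.1.pos
  let index (k : t) : Fin n := ⟨k - 1, by have := hn k k.2; have := hpos k; omega⟩
  have hindex : Function.Injective index := fun k l h =>
    Subtype.ext <| PNat.eq <| by rw [← hpos k, ← hpos l]; exact congrArg (· + 1) (Fin.ext_iff.1 h)
  have hpsum := ((algebraicIndependent_psum (σ := Fin n) (R := ℚ) (Fintype.card_fin n)).map'
    (f := coeToMvPowerSeries.algHom ℚ) fun p q h => coe_injective _ _ (by simpa using h)).comp
      index hindex
  refine .of_comp (MvPowerSeries.killCompl (R := ℚ) (Fin.valEmbedding (n := n))) ?_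
  convert! hpsum using 1
  ext1 k
  simp [killCompl_powerSum, index, hpos]

end AlgebraicIndependence

section QFunctions

theorem coeff_powerSum_mul (k : ℕ+) (f : MvPowerSeries ℕ ℚ) (d : ℕ →₀ ℕ) :
    MvPowerSeries.coeff d (powerSum k * f) = ∑ j ∈ d.support,
      if (k : ℕ) ≤ d j then MvPowerSeries.coeff (d - Finsupp.single j (k : ℕ)) f else 0 := by
  open scoped MvPowerSeries.WithPiTopology in
  have hcoeff := ((summable_powerSum k).hasSum.mul_right f).map (MvPowerSeries.coeff (R := ℚ) d)
    (MvPowerSeries.WithPiTopology.continuous_coeff ℚ d)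
  simp only [Function.comp_def, MvPowerSeries.X_pow_eq, MvPowerSeries.coeff_monomial_mul, one_mul,
    Finsupp.single_le_iff] at hcoeff
  rw [powerSum]
  simp only [MvPowerSeries.X_pow_eq]
  refine hcoeff.unique (hasSum_sum_of_ne_finset_zero fun j hj => if_neg ?_)
  simp [Finsupp.notMem_support_iff.1 hj]

theorem card_support_tsub_single {d : ℕ →₀ ℕ} {j k : ℕ} (hk : 0 < k) (hkd : k ≤ d j) :
    (d - Finsupp.single j k).support.card + (if k = d j then 1 else 0) = d.support.card := by
  have hj : j ∈ d.support := Finsupp.mem_support_iff.2 (by omega)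
  split_ifs with h
  · have hsupp : (d - Finsupp.single j k).support = d.support.erase j := by
      ext l
      by_cases hl : l = j <;> simp [hl, h]
    rw [hsupp, card_erase_add_one hj]
  · rw [add_zero]
    congr 1
    ext l
    rcases eq_or_ne j l with rfl | hl
    · simp; omega
    · simp [hl]

theorem coeff_powerSum_mul_qFun (k : ℕ+) (n : ℕ) (d : ℕ →₀ ℕ) :
    MvPowerSeries.coeff d (powerSum k * qFun n) = if d.degree = n + k then
      2 ^ (d.support.card - 1) *
        ((∑ j ∈ d.support, if (k : ℕ) < d j then 2 else if k = d j then 1 else 0 : ℕ) : ℚ)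
    else 0 := by
  have hterm (j : ℕ) (hj : j ∈ d.support) :
      (if (k : ℕ) ≤ d j then MvPowerSeries.coeff (d - Finsupp.single j (k : ℕ)) (qFun n) else 0) =
      if d.degree = n + k then 2 ^ (d.support.card - 1) *
        ((if (k : ℕ) < d j then 2 else if k = d j then 1 else 0 : ℕ) : ℚ) else 0 := by
    by_cases hkd : (k : ℕ) ≤ d j
    swap
    · simp [hkd, show ¬ (k : ℕ) < d j by omega, show (k : ℕ) ≠ d j by omega]
    have hdegree : (d - Finsupp.single j (k : ℕ)).degree + k = d.degree := by
      conv_rhs => rw [← tsub_add_cancel_of_le (Finsupp.single_le_iff.2 hkd), map_add,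
        Finsupp.degree_single]
    have hcard := card_support_tsub_single k.pos hkd
    have hpos : 0 < d.support.card := card_pos.2 ⟨j, hj⟩
    rw [if_pos hkd, coeff_qFun, ← hdegree]
    refine if_congr (by omega) ?_ rfl
    rcases hkd.lt_or_eq with hlt | heq
    · simp only [hlt.ne, if_false, add_zero] at hcard
      rw [if_pos hlt, hcard, Nat.cast_ofNat, ← pow_succ, Nat.sub_add_cancel hpos]
    · simp only [heq, if_true] at hcard
      simp [heq, ← hcard]
  rw [coeff_powerSum_mul, sum_congr rfl hterm]
  split_ifs
  · rw [Nat.cast_sum, mul_sum]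
  · exact sum_const_zero

theorem sum_range_even_ite (n a : ℕ) :
    (∑ i ∈ range n, if Even i then if i + 1 < a then 2 else if i + 1 = a then 1 else 0 else 0) =
      if n < a then n + n % 2 else a := by
  induction n with
  | zero => rw [sum_range_zero]; split_ifs <;> omega
  | succ n ih =>
    rw [sum_range_succ, ih]
    simp only [Nat.even_iff]
    split_ifs <;> omega

/-- The logarithmic derivative of `∏ᵢ (1 + xᵢ t) / (1 - xᵢ t)` is `2 ∑ p_k t ^ (k - 1)`, the sum
being over all odd `k`. -/
theorem succ_smul_qFun_succ (n : ℕ) : ((n : ℚ) + 1) • qFun (n + 1) =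
    (2 : ℚ) • ∑ i ∈ range (n + 1), if Even i then powerSum i.succPNat * qFun (n - i) else 0 := by
  ext d
  have hterm (i : ℕ) (hi : i ∈ range (n + 1)) : MvPowerSeries.coeff d
      (if Even i then powerSum i.succPNat * qFun (n - i) else 0) =
      if d.degree = n + 1 then 2 ^ (d.support.card - 1) * ((∑ j ∈ d.support, if Even i then
        if i + 1 < d j then 2 else if i + 1 = d j then 1 else 0 else 0 : ℕ) : ℚ) else 0 := by
    have hdegree : n - i + i.succPNat = n + 1 := by
      have := mem_range.1 hi
      simp; omega
    by_cases he : Even i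
    · simp only [he, if_true]
      rw [coeff_powerSum_mul_qFun, hdegree, Nat.succPNat_coe]
    · simp [he]
  simp only [map_smul, map_sum, smul_eq_mul, coeff_qFun]
  rw [sum_congr rfl hterm]
  split_ifs with hd
  swap
  · simp
  have hsum : ∑ j ∈ d.support, d j = n + 1 := hd
  have hpos : 0 < d.support.card := card_pos.2 <| Finsupp.support_nonempty_iff.2 <| by
    rintro rfl
    simp at hd
  rw [← mul_sum, ← Nat.cast_sum, sum_comm]
  simp only [sum_range_even_ite]
  rw [sum_congr rfl fun j _ => if_neg (not_lt.2 (hd ▸ Finsupp.le_degree j d)), hsum]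
  conv_lhs => rw [← Nat.sub_add_cancel hpos, pow_succ]
  push_cast
  ring

theorem qFun_zero : qFun 0 = 1 := by
  ext d
  rw [coeff_qFun, MvPowerSeries.coeff_one]
  by_cases h : d = 0 <;> simp [h, Finsupp.degree_eq_zero_iff]

open MvPolynomial

/-- The polynomial in the power sums that expresses `q_n`. -/
def qPoly : ℕ → MvPolynomial ℕ+ ℚ
  | 0 => 1
  | n + 1 => (2 / ((n : ℚ) + 1)) • ∑ i : Fin (n + 1),
      if Even (i : ℕ) then X (i : ℕ).succPNat * qPoly (n - i) else 0

theorem qPoly_zero : qPoly 0 = 1 := by rw [qPoly]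

theorem qPoly_succ (n : ℕ) : qPoly (n + 1) = (2 / ((n : ℚ) + 1)) •
    ∑ i ∈ range (n + 1), if Even i then X i.succPNat * qPoly (n - i) else 0 := by
  rw [qPoly, Fin.sum_univ_eq_sum_range fun i =>
    if Even i then X (R := ℚ) i.succPNat * qPoly (n - i) else 0]

theorem aeval_qPoly (n : ℕ) : aeval powerSum (qPoly n) = qFun n := by
  induction n using Nat.strong_induction_on with
  | _ n ih =>
    cases n with
    | zero => rw [qPoly_zero, map_one, qFun_zero]
    | succ n =>
      have hn : (n : ℚ) + 1 ≠ 0 := by positivity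
      refine smul_right_injective _ hn ?_
      simp only [succ_smul_qFun_succ, qPoly_succ, map_smul, map_sum, smul_smul,
        mul_div_cancel₀ _ hn]
      congr 1
      refine sum_congr rfl fun i _ => ?_
      split_ifs
      · rw [map_mul, aeval_X, ih _ (by omega)]
      · exact map_zero _

theorem sum_range_X_mul_qPoly (n : ℕ) :
    (∑ i ∈ range n, if Even i then X i.succPNat * qPoly (n - 1 - i) else 0) =
      ((n : ℚ) / 2) • qPoly n := by
  cases n with
  | zero => simp
  | succ n =>
    rw [qPoly_succ, smul_smul, Nat.cast_succ, div_mul_div_cancel₀' (by positivity)]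
    field_simp
    simp

theorem pderiv_X_succPNat_mul (k : ℕ+) (i : ℕ) (f : MvPolynomial ℕ+ ℚ) :
    pderiv k (X i.succPNat * f) = X i.succPNat * pderiv k f + if i + 1 = k then f else 0 := by
  have hik : i.succPNat = k ↔ i + 1 = k := by rw [← PNat.coe_inj, Nat.succPNat_coe]
  simp [Derivation.leibniz, pderiv_X, Pi.single_apply, hik]

theorem pderiv_ite_X_mul_qPoly {k : ℕ+} (hk : Odd (k : ℕ)) {n i : ℕ} (hkn : k ≤ n + 1) (hi : i ≤ n)
    (h : pderiv k (qPoly (n - i)) =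
      if Odd (k : ℕ) ∧ k ≤ n - i then (2 / (k : ℚ)) • qPoly (n - i - k) else 0) :
    pderiv k (if Even i then X i.succPNat * qPoly (n - i) else 0) =
      (if i < n + 1 - k then
        (2 / (k : ℚ)) • if Even i then X i.succPNat * qPoly (n + 1 - k - 1 - i) else 0
      else 0) + if i = k - 1 then qPoly (n + 1 - k) else 0 := by
  have := k.pos
  have hle : (k : ℕ) ≤ n - i ↔ i < n + 1 - k := by omega
  have hsub : n - i - k = n + 1 - k - 1 - i := by omega
  have hne : ¬ Even i → i ≠ k - 1 := by grind
  have heq : i + 1 = k ↔ i = k - 1 := by omega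
  by_cases he : Even i
  · simp only [he, if_true, pderiv_X_succPNat_mul, h, hk, true_and, hle, hsub, mul_ite, mul_zero,
      mul_smul_comm, heq]
    refine congrArg _ (if_ctx_congr Iff.rfl (fun h => congrArg qPoly ?_) fun _ => rfl)
    omega
  · simp [he, hne he]

theorem pderiv_qPoly (k : ℕ+) (n : ℕ) : pderiv k (qPoly n) =
    if Odd (k : ℕ) ∧ k ≤ n then (2 / (k : ℚ)) • qPoly (n - k) else 0 := by
  induction n using Nat.strong_induction_on with
  | _ n ih =>
    cases n with
    | zero => simp [qPoly_zero]
    | succ n =>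
      rw [qPoly_succ, Derivation.map_smul, map_sum]
      split_ifs with hk
      · have hfilter : (range (n + 1)).filter (· < n + 1 - k) = range (n + 1 - k) := by
          ext; simp; omega
        have hk0 : (k : ℚ) ≠ 0 := by positivity
        have hn0 : (n : ℚ) + 1 ≠ 0 := by positivity
        rw [sum_congr rfl fun i hi => pderiv_ite_X_mul_qPoly hk.1 hk.2
            (Nat.lt_succ_iff.1 (mem_range.1 hi)) (ih (n - i) (by omega)),
          sum_add_distrib, sum_ite_eq', if_pos (mem_range.2 (by omega)), ← sum_filter, hfilter,
          ← smul_sum, sum_range_X_mul_qPoly, smul_smul, smul_add, smul_smul, ← add_smul,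
          Nat.cast_sub hk.2]
        congr 1
        push_cast
        field_simp
        ring
      · refine (congrArg _ (sum_eq_zero fun i hi => ?_)).trans (smul_zero _)
        have := mem_range.1 hi
        split_ifs with he
        · have hne : i + 1 ≠ k := by grind
          have hik : ¬ (Odd (k : ℕ) ∧ (k : ℕ) ≤ n - i) := fun h => hk ⟨h.1, by omega⟩
          rw [pderiv_X_succPNat_mul, ih _ (by omega), if_neg hik, if_neg hne, mul_zero, add_zero]
        · exact map_zero _

end QFunctions

section AltSum

variable {α M N : Type*} [AddCommGroup M] [AddCommGroup N]

/-- The sum `∑ m, (-1) ^ m • f l[m] (l without its entry at m)` over the positions of the list `l`,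
the shape of the recurrences for `Q_λ`. -/
def altSum (f : α → List α → M) (l : List α) : M :=
  ∑ m : Fin l.length, (-1 : ℤ) ^ (m : ℕ) • f (l.get m) (l.eraseIdx m)

theorem altSum_congr {f g : α → List α → M} {l : List α}
    (h : ∀ m : Fin l.length, f (l.get m) (l.eraseIdx m) = g (l.get m) (l.eraseIdx m)) :
    altSum f l = altSum g l :=
  sum_congr rfl fun m _ => congrArg _ (h m)

theorem altSum_nil (f : α → List α → M) : altSum f [] = 0 := Fin.sum_univ_zero _

theorem altSum_cons (f : α → List α → M) (a : α) (t : List α) :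
    altSum f (a :: t) = f a t - altSum (fun y r => f y (a :: r)) t := by
  simp only [altSum, List.length_cons, sub_eq_add_neg, ← sum_neg_distrib]
  refine (Fin.sum_univ_succ _).trans ?_
  simp [pow_succ]

theorem altSum_sub (f g : α → List α → M) (l : List α) :
    altSum (fun y r => f y r - g y r) l = altSum f l - altSum g l := by
  simp only [altSum, smul_sub, sum_sub_distrib]

theorem map_altSum {F : Type*} [FunLike F M N] [AddMonoidHomClass F M N] (φ : F)
    (f : α → List α → M) (l : List α) :
    φ (altSum f l) = altSum (fun y r => φ (f y r)) l := by
  simp only [altSum, map_sum, map_zsmul]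

theorem mul_altSum {R : Type*} [Ring R] (c : R) (f : α → List α → R) (l : List α) :
    c * altSum f l = altSum (fun y r => c * f y r) l :=
  map_altSum (AddMonoidHom.mulLeft c) f l

theorem altSum_append_singleton (f : α → List α → M) (l : List α) (z : α) :
    altSum f (l ++ [z]) = altSum (fun y r => f y (r ++ [z])) l + (-1 : ℤ) ^ l.length • f z l := by
  induction l generalizing f with
  | nil => simp [altSum_cons, altSum_nil]
  | cons a t ih =>
    simp only [List.cons_append, altSum_cons, ih, List.length_cons, pow_succ, mul_neg, mul_one,
      neg_smul]
    abel

theorem altSum_altSum_swap (g : α → α → List α → M) (l : List α) :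
    altSum (fun x r => altSum (fun y s => g x y s) r) l =
      -altSum (fun x r => altSum (fun y s => g y x s) r) l := by
  induction l generalizing g with
  | nil => simp only [altSum_nil, neg_zero]
  | cons a t ih =>
    simp only [altSum_cons, altSum_sub]
    rw [ih]
    abel

theorem altSum_const_of_odd (c : M) {l : List α} (hl : Odd l.length) :
    altSum (fun _ _ => c) l = c := by
  rw [altSum, ← sum_smul, Fin.sum_neg_one_pow, if_neg (Nat.not_even_iff_odd.2 hl), one_smul]

section Nodup

variable [DecidableEq α] {f g : α → List α → M} {l : List α}

theorem altSum_eq_of_nodup (hl : l.Nodup) (f : α → List α → M) :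
    altSum f l = ∑ m : Fin l.length, (-1 : ℤ) ^ (m : ℕ) • f (l.get m) (l.erase (l.get m)) :=
  sum_congr rfl fun m _ => by rw [List.get_eq_getElem, hl.erase_getElem]

theorem altSum_congr_of_nodup (hl : l.Nodup) (h : ∀ y ∈ l, f y (l.erase y) = g y (l.erase y)) :
    altSum f l = altSum g l := by
  rw [altSum_eq_of_nodup hl, altSum_eq_of_nodup hl]
  exact sum_congr rfl fun m _ => congrArg _ (h _ (l.get_mem m))

theorem exists_mem_of_altSum_ne_zero (hl : l.Nodup) (h : altSum f l ≠ 0) :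
    ∃ y ∈ l, f y (l.erase y) ≠ 0 := by
  rw [altSum_eq_of_nodup hl] at h
  obtain ⟨m, -, hm⟩ := exists_ne_zero_of_sum_ne_zero h
  exact ⟨_, l.get_mem m, right_ne_zero_of_smul hm⟩

theorem altSum_ne_zero_of_unique (hl : l.Nodup) {c : α} (hc : c ∈ l) (hne : f c (l.erase c) ≠ 0)
    (hzero : ∀ y ∈ l, y ≠ c → f y (l.erase y) = 0) : altSum f l ≠ 0 := by
  obtain ⟨m, rfl⟩ := List.get_of_mem hc
  rw [altSum_eq_of_nodup hl, sum_eq_single m]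
  · rcases neg_one_pow_eq_or ℤ (m : ℕ) with h | h <;> simpa [h] using hne
  · intro k _ hkm
    rw [hzero _ (l.get_mem k) (hl.injective_get.ne hkm), smul_zero]
  · exact fun h => absurd (mem_univ m) h

end Nodup

end AltSum

section SchurQPoly

open MvPolynomial

/-- The coefficient of `q_{a+m} q_{b-m}` in `Q_{(a,b)}`. -/
def qTwoCoeff (m : ℕ) : ℚ := if m = 0 then 1 else 2 * (-1) ^ m

/-- The polynomial in the power sums that expresses `Q_{(a,b)}`. -/
def qTwoPoly (a b : ℕ) : MvPolynomial ℕ+ ℚ :=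
  ∑ m ∈ range (b + 1), qTwoCoeff m • (qPoly (a + m) * qPoly (b - m))

theorem aeval_qTwoPoly (a b : ℕ) : aeval powerSum (qTwoPoly a b) = schurQTwo a b := by
  rw [qTwoPoly, schurQTwo, range_eq_Ico, sum_eq_sum_Ico_succ_bot b.succ_pos, mul_sum]
  simp only [map_add, map_sum, map_smul, map_mul, aeval_qPoly, zero_add]
  congr 1
  · simp [qTwoCoeff]
  · refine sum_congr rfl fun m hm => ?_
    have hm : m ≠ 0 := by have := mem_Ico.1 hm; omega
    rw [qTwoCoeff, if_neg hm, Algebra.smul_def, map_mul, map_pow, map_neg, map_one, map_ofNat,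
      mul_assoc]

theorem qTwoPoly_zero_right (a : ℕ) : qTwoPoly a 0 = qPoly a := by
  simp [qTwoPoly, qTwoCoeff, qPoly_zero]

/-- The polynomial in the power sums that expresses `Q_l`. -/
def schurQPoly : List ℕ → MvPolynomial ℕ+ ℚ
  | [] => 1
  | a :: t =>
    if Odd (a :: t).length then
      ∑ m : Fin (a :: t).length,
        (-1) ^ (m : ℕ) * (qPoly ((a :: t).get m) * schurQPoly ((a :: t).eraseIdx m))
    else
      ∑ m : Fin t.length, (-1) ^ (m : ℕ) * (qTwoPoly a (t.get m) * schurQPoly (t.eraseIdx m))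
termination_by l => l.length
decreasing_by all_goals grind

theorem aeval_schurQPoly (l : List ℕ) : aeval powerSum (schurQPoly l) = schurQ l := by
  induction l using schurQPoly.induct with
  | case1 => rw [schurQPoly, schurQ, map_one]
  | case2 a t hodd ih =>
    rw [schurQPoly, schurQ, if_pos hodd, if_pos hodd]
    simp only [map_sum, map_mul, map_pow, map_neg, map_one, aeval_qPoly, ih]
  | case3 a t hodd ih =>
    rw [schurQPoly, schurQ, if_neg hodd, if_neg hodd]
    simp only [map_sum, map_mul, map_pow, map_neg, map_one, aeval_qTwoPoly, ih]

theorem schurQPoly_nil : schurQPoly [] = 1 := by rw [schurQPoly]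

theorem schurQPoly_of_odd {l : List ℕ} (hl : Odd l.length) :
    schurQPoly l = altSum (fun y r => qPoly y * schurQPoly r) l := by
  cases l with
  | nil => simp at hl
  | cons a t =>
    rw [schurQPoly, if_pos hl]
    simp [altSum, zsmul_eq_mul]

theorem schurQPoly_cons (a : ℕ) {t : List ℕ} (ht : Odd t.length) :
    schurQPoly (a :: t) = altSum (fun y r => qTwoPoly a y * schurQPoly r) t := by
  have hlen : ¬ Odd (a :: t).length := by rwa [List.length_cons, Nat.odd_add_one, not_not]
  rw [schurQPoly, if_neg hlen]
  simp [altSum, zsmul_eq_mul]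

theorem schurQPoly_append_zero {l : List ℕ} (hl : Odd l.length) :
    schurQPoly (l ++ [0]) = schurQPoly l := by
  induction hn : l.length using Nat.strong_induction_on generalizing l with
  | _ n ih =>
    subst hn
    obtain ⟨x, t, rfl⟩ := List.exists_cons_of_length_pos hl.pos
    have ht : Even t.length := by simpa [Nat.odd_add_one] using hl
    have hodd (m : Fin t.length) : Odd (t.eraseIdx m).length := by
      grind
    have hpadded : altSum (fun y r => qTwoPoly x y * schurQPoly (r ++ [0])) t =
        altSum (fun y r => altSum (fun z s => qTwoPoly x y * (qPoly z * schurQPoly s)) r) t :=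
      altSum_congr fun m => by
        rw [ih _ (by grind) (hodd m) rfl, schurQPoly_of_odd (hodd m), mul_altSum]
    have hunpadded : altSum (fun y r => qPoly y * schurQPoly (x :: r)) t =
        altSum (fun y r => altSum (fun z s => qTwoPoly x z * (qPoly y * schurQPoly s)) r) t :=
      altSum_congr fun m => by
        simp only [schurQPoly_cons x (hodd m), mul_altSum, mul_left_comm]
    rw [List.cons_append, schurQPoly_cons x (by simpa using ht.add_one), altSum_append_singleton,
      ht.neg_one_pow, one_smul, qTwoPoly_zero_right, schurQPoly_of_odd hl, altSum_cons, hpadded,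
      hunpadded, altSum_altSum_swap]
    ring

theorem isPowerSumExpansion_schurQ_iff {F : MvPolynomial ℕ+ ℚ} {l : List ℕ} :
    IsPowerSumExpansion F (schurQ l) ↔ F = schurQPoly l := by
  rw [IsPowerSumExpansion, ← aeval_schurQPoly]
  exact (algebraicIndependent_iff_injective_aeval.1 algebraicIndependent_powerSum).eq_iff

end SchurQPoly

section LowDegreeCoefficients

open MvPolynomial

section General

variable {σ R : Type*} [CommSemiring R]

/-- The coefficient of a variable, as a derivative at the origin. -/
def linCoeff (i : σ) : MvPolynomial σ R →ₗ[R] R := lcoeff R 0 ∘ₗ (pderiv i).toLinearMap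

/-- The second partial derivatives at the origin: up to a factor `2` if `i = j`, the coefficient
of the product of two variables. -/
def quadCoeff (i j : σ) : MvPolynomial σ R →ₗ[R] R := linCoeff i ∘ₗ (pderiv j).toLinearMap

theorem linCoeff_apply (i : σ) (F : MvPolynomial σ R) :
    linCoeff i F = constantCoeff (pderiv i F) := rfl

theorem quadCoeff_apply (i j : σ) (F : MvPolynomial σ R) :
    quadCoeff i j F = linCoeff i (pderiv j F) := rfl

theorem linCoeff_eq_coeff (i : σ) (F : MvPolynomial σ R) :
    linCoeff i F = coeff (Finsupp.single i 1) F := by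
  rw [linCoeff_apply, constantCoeff_eq, coeff_pderiv]
  simp

theorem quadCoeff_eq_coeff (i j : σ) (F : MvPolynomial σ R) : quadCoeff i j F =
    coeff (Finsupp.single i 1 + Finsupp.single j 1) F * (Finsupp.single i 1 j + 1 : ℕ) := by
  rw [quadCoeff_apply, linCoeff_eq_coeff, coeff_pderiv, Nat.cast_add_one]

theorem linCoeff_mul (i : σ) (F G : MvPolynomial σ R) : linCoeff i (F * G) =
    linCoeff i F * constantCoeff G + constantCoeff F * linCoeff i G := by
  simp only [linCoeff_apply, pderiv_mul, map_add, map_mul]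

theorem quadCoeff_mul (i j : σ) (F G : MvPolynomial σ R) : quadCoeff i j (F * G) =
    quadCoeff i j F * constantCoeff G + linCoeff i F * linCoeff j G + linCoeff j F * linCoeff i G
      + constantCoeff F * quadCoeff i j G := by
  simp only [quadCoeff_apply, pderiv_mul, map_add, linCoeff_mul, ← linCoeff_apply]
  ring

end General

theorem constantCoeff_qPoly (n : ℕ) : constantCoeff (qPoly n) = if n = 0 then 1 else 0 := by
  cases n with
  | zero => simp [qPoly_zero]
  | succ n =>
    rw [qPoly_succ, if_neg n.succ_ne_zero, constantCoeff_smul, map_sum, sum_eq_zero, smul_zero]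
    intro i _
    split_ifs <;> simp

theorem linCoeff_qPoly (k : ℕ+) (n : ℕ) :
    linCoeff k (qPoly n) = if n = k ∧ Odd (k : ℕ) then 2 / (k : ℚ) else 0 := by
  rw [linCoeff_apply, pderiv_qPoly]
  split_ifs with hle heq heq
  · simp [constantCoeff_qPoly, heq.1]
  · simp [constantCoeff_qPoly, show n - k ≠ 0 by grind]
  · exact absurd ⟨heq.2, heq.1.ge⟩ hle
  · exact map_zero _

theorem quadCoeff_qPoly (i j : ℕ+) (n : ℕ) : quadCoeff i j (qPoly n) =
    if n = i + j ∧ Odd (i : ℕ) ∧ Odd (j : ℕ) then 4 / ((i : ℚ) * j) else 0 := by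
  rw [quadCoeff_apply, pderiv_qPoly]
  split_ifs with hle heq heq
  · rw [map_smul, linCoeff_qPoly, if_pos ⟨by omega, heq.2.1⟩, smul_eq_mul]
    field_simp
    norm_num
  · rw [map_smul, linCoeff_qPoly, if_neg (by grind), smul_zero]
  · exact absurd ⟨heq.2.2, by omega⟩ hle
  · exact map_zero _

theorem linCoeff_qTwoPoly {a b : ℕ} (ha : 0 < a) {k : ℕ+} (hk : (k : ℕ) = a + b)
    (hodd : Odd (k : ℕ)) : linCoeff k (qTwoPoly a b) = qTwoCoeff b * (2 / (k : ℚ)) := by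
  have hterm (m : ℕ) (hm : m ∈ range (b + 1)) :
      linCoeff k (qTwoCoeff m • (qPoly (a + m) * qPoly (b - m))) =
        if m = b then qTwoCoeff b * (2 / (k : ℚ)) else 0 := by
    have := mem_range.1 hm
    rw [map_smul, linCoeff_mul, linCoeff_qPoly, linCoeff_qPoly, constantCoeff_qPoly,
      constantCoeff_qPoly, if_neg (show a + m ≠ 0 by omega), smul_eq_mul]
    split_ifs <;> simp_all
  rw [qTwoPoly, map_sum, sum_congr rfl hterm, sum_ite_eq', if_pos (by simp)]

theorem quadCoeff_qTwoPoly {a b : ℕ} (hab : b < a) {i j : ℕ+} (hij : (i : ℕ) + j = a + b)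
    (hle : i ≤ j) (hi : Odd (i : ℕ)) (hj : Odd (j : ℕ)) :
    quadCoeff i j (qTwoPoly a b) =
      (qTwoCoeff b + if a ≤ j then qTwoCoeff (j - a) else 0) * (4 / ((i : ℚ) * j)) := by
  have hi0 := i.pos
  have hle : (i : ℕ) ≤ j := hle
  have hterm (m : ℕ) (hm : m ∈ range (b + 1)) :
      quadCoeff i j (qTwoCoeff m • (qPoly (a + m) * qPoly (b - m))) =
        (if m = b then qTwoCoeff b * (4 / ((i : ℚ) * j)) else 0) +
          if m = j - a then
            (if a ≤ j then qTwoCoeff (j - a) * (4 / ((i : ℚ) * j)) else 0) else 0 := by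
    have := mem_range.1 hm
    rw [map_smul, quadCoeff_mul]
    simp only [quadCoeff_qPoly, linCoeff_qPoly, constantCoeff_qPoly, hi, hj, and_true]
    rw [if_neg (show a + m ≠ i by omega), if_neg (show a + m ≠ 0 by omega), zero_mul, zero_mul,
      add_zero, add_zero, smul_add]
    congr 1
    · by_cases hmb : m = b
      · subst hmb
        simp [hij]
      · rw [if_neg (show b - m ≠ 0 by omega), if_neg hmb, mul_zero, smul_zero]
    · by_cases hmj : a + m = j
      · rw [if_pos hmj, if_pos (show b - m = i by omega), if_pos (show m = j - a by omega),
          if_pos (show a ≤ j by omega), show m = j - a by omega, smul_eq_mul]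
        field_simp
        norm_num
      · rw [if_neg hmj, zero_mul, smul_zero]
        split_ifs <;> first | rfl | omega
  rw [qTwoPoly, map_sum, sum_congr rfl hterm, sum_add_distrib, sum_ite_eq', sum_ite_eq',
    if_pos (by simp), if_pos (by rw [mem_range]; omega), add_mul, ite_mul, zero_mul]

theorem qTwoCoeff_ne_zero (m : ℕ) : qTwoCoeff m ≠ 0 := by
  rw [qTwoCoeff]
  split_ifs <;> simp

theorem qTwoCoeff_of_odd {m : ℕ} (hm : Odd m) : qTwoCoeff m = -2 := by
  rw [qTwoCoeff, if_neg hm.pos.ne', hm.neg_one_pow]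
  norm_num

theorem qTwoCoeff_add_eq_zero {m n : ℕ} (hm : 0 < m) (hn : 0 < n) (hmn : Odd (m + n)) :
    qTwoCoeff m + qTwoCoeff n = 0 := by
  rw [qTwoCoeff, qTwoCoeff, if_neg hm.ne', if_neg hn.ne']
  rcases Nat.even_or_odd m with h | h
  · rw [h.neg_one_pow, ((Nat.odd_add'.1 hmn).2 h).neg_one_pow]
    norm_num
  · rw [h.neg_one_pow, ((Nat.odd_add.1 hmn).1 h).neg_one_pow]
    norm_num

end LowDegreeCoefficients

section PairTerms

open MvPolynomial

/-- The bidegree of `p_k`: its degree as a symmetric function, and the parity of its length.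
Only power sums of odd index occur in `Q_l`, so that in a term of `Q_l` the second component is
the parity of the first. -/
def bidegree (k : ℕ+) : ℕ × ZMod 2 := (k, 1)

theorem weight_bidegree (m : ℕ+ →₀ ℕ) : Finsupp.weight bidegree m =
    (Finsupp.weight (fun k : ℕ+ => (k : ℕ)) m, (m.degree : ZMod 2)) := by
  induction m using Finsupp.induction_linear with
  | zero => simp [Prod.mk_zero_zero]
  | add f g hf hg => simp [hf, hg]
  | single k c => simp [Finsupp.weight_single, bidegree]

theorem isWeightedHomogeneous_qPoly (n : ℕ) :
    IsWeightedHomogeneous bidegree (qPoly n) ((n, n) : ℕ × ZMod 2) := by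
  induction n using Nat.strong_induction_on with
  | _ n ih =>
    cases n with
    | zero =>
      rw [qPoly_zero, Nat.cast_zero]
      exact isWeightedHomogeneous_one ℚ bidegree
    | succ n =>
      rw [qPoly_succ, smul_eq_C_mul]
      refine (IsWeightedHomogeneous.sum _ _ _ fun i hi => ?_).C_mul _
      have hi := mem_range.1 hi
      split_ifs with heven
      · have hn : n + 1 = i + 1 + (n - i) := by omega
        have hbidegree : bidegree i.succPNat = ((i + 1 : ℕ), ((i + 1 : ℕ) : ZMod 2)) :=
          Prod.ext rfl (ZMod.natCast_eq_one_iff_odd.2 heven.add_one).symm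
        rw [hn, Nat.cast_add, ← Prod.mk_add_mk, ← hbidegree]
        exact (isWeightedHomogeneous_X ℚ bidegree _).mul (ih _ (by omega))
      · exact isWeightedHomogeneous_zero _ _ _

theorem isWeightedHomogeneous_qTwoPoly (a b : ℕ) :
    IsWeightedHomogeneous bidegree (qTwoPoly a b) (a + b, ((a + b : ℕ) : ZMod 2)) := by
  refine IsWeightedHomogeneous.sum _ _ _ fun m hm => ?_
  have hm := mem_range.1 hm
  have hab : a + b = a + m + (b - m) := by omega
  rw [smul_eq_C_mul, hab, Nat.cast_add, ← Prod.mk_add_mk]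
  exact ((isWeightedHomogeneous_qPoly _).mul (isWeightedHomogeneous_qPoly _)).C_mul _

theorem qPoly_mem_supported_odd (n : ℕ) : qPoly n ∈ supported ℚ {k : ℕ+ | Odd (k : ℕ)} := by
  induction n using Nat.strong_induction_on with
  | _ n ih =>
    cases n with
    | zero => exact qPoly_zero ▸ one_mem _
    | succ n =>
      rw [qPoly_succ]
      refine Subalgebra.smul_mem _ (sum_mem fun i _ => ?_) _
      split_ifs with heven
      · exact mul_mem (X_mem_supported.2 heven.add_one) (ih _ (by omega))
      · exact zero_mem _

theorem qTwoPoly_mem_supported_odd (a b : ℕ) :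
    qTwoPoly a b ∈ supported ℚ {k : ℕ+ | Odd (k : ℕ)} :=
  sum_mem fun _ _ => Subalgebra.smul_mem _
    (mul_mem (qPoly_mem_supported_odd _) (qPoly_mem_supported_odd _)) _

section CoeffNeZero

variable {a b : ℕ} {m : ℕ+ →₀ ℕ}

theorem odd_of_coeff_qTwoPoly_ne_zero (h : coeff m (qTwoPoly a b) ≠ 0) {k : ℕ+}
    (hk : k ∈ m.support) : Odd (k : ℕ) :=
  mem_supported.1 (qTwoPoly_mem_supported_odd a b)
    (mem_coe.2 ((mem_vars_iff_mem_support k).2 ⟨m, mem_support_iff.2 h, hk⟩))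

theorem weight_eq_of_coeff_qTwoPoly_ne_zero (h : coeff m (qTwoPoly a b) ≠ 0) :
    Finsupp.weight (fun k : ℕ+ => (k : ℕ)) m = a + b := by
  have := isWeightedHomogeneous_qTwoPoly a b h
  rw [weight_bidegree] at this
  exact congrArg Prod.fst this

theorem degree_mod_two_of_coeff_qTwoPoly_ne_zero (h : coeff m (qTwoPoly a b) ≠ 0) :
    m.degree % 2 = (a + b) % 2 := by
  have := isWeightedHomogeneous_qTwoPoly a b h
  rw [weight_bidegree] at this
  exact (ZMod.natCast_eq_natCast_iff' _ _ 2).1 (congrArg Prod.snd this)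

theorem le_degree_of_coeff_qTwoPoly_ne_zero (ha : 0 < a) (h : coeff m (qTwoPoly a b) ≠ 0) :
    2 - (a + b) % 2 ≤ m.degree := by
  have hmod := degree_mod_two_of_coeff_qTwoPoly_ne_zero h
  have hdegree : m.degree ≠ 0 := by
    rw [Ne, Finsupp.degree_eq_zero_iff]
    rintro rfl
    have := weight_eq_of_coeff_qTwoPoly_ne_zero h
    rw [map_zero] at this
    omega
  omega

theorem le_add_of_coeff_qTwoPoly_ne_zero (h : coeff m (qTwoPoly a b) ≠ 0) {k : ℕ+}
    (hk : k ∈ m.support) : (k : ℕ) ≤ a + b :=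
  weight_eq_of_coeff_qTwoPoly_ne_zero h ▸
    Finsupp.le_weight_of_ne_zero' _ (Finsupp.mem_support_iff.1 hk)

/-- A term `p_k p_j` with `k > a` comes from both `q_k q_j` and `q_{a+b} q_0`, with opposite
coefficients. -/
theorem le_of_coeff_qTwoPoly_ne_zero (hab : b < a) (h : coeff m (qTwoPoly a b) ≠ 0)
    (hm : m.degree = 2) {k : ℕ+} (hk : k ∈ m.support) : (k : ℕ) ≤ a := by
  by_contra! hlt
  obtain ⟨n, rfl⟩ := exists_add_of_le
    (Finsupp.single_le_iff.2 (Nat.one_le_iff_ne_zero.2 (Finsupp.mem_support_iff.1 hk)))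
  obtain ⟨j, rfl⟩ : ∃ j, n = Finsupp.single j 1 := by
    rw [map_add, Finsupp.degree_single] at hm
    exact (Finsupp.sum_eq_one_iff n).1 (by change n.degree = 1; omega)
  have hweight := weight_eq_of_coeff_qTwoPoly_ne_zero h
  simp only [map_add, Finsupp.weight_single, one_smul] at hweight
  have hj : Odd (j : ℕ) := odd_of_coeff_qTwoPoly_ne_zero h (by simp)
  have hquad := quadCoeff_qTwoPoly hab (i := j) (by omega)
    (PNat.coe_le_coe _ _ |>.1 (by omega)) hj (odd_of_coeff_qTwoPoly_ne_zero h hk)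
  rw [if_pos hlt.le, qTwoCoeff_add_eq_zero (by omega) (by omega) (by grind), zero_mul,
    quadCoeff_eq_coeff, add_comm (Finsupp.single j 1)] at hquad
  exact h ((mul_eq_zero.1 hquad).resolve_right (by positivity))

end CoeffNeZero

end PairTerms

section ParityRank

/-- The number of odd entries. -/
def oddCount (l : List ℕ) : ℕ := l.countP (· % 2 = 1)

/-- The number of even entries. -/
def evenCount (l : List ℕ) : ℕ := l.countP (· % 2 = 0)

/-- The common value of the shifted rank of `l` and of the least length of a term in the power sum
expansion of `Q_l`. The summand `l.length % 2` counts the zero that pads `l` to even length. -/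
def parityRank (l : List ℕ) : ℕ := max (oddCount l) (evenCount l + l.length % 2)

theorem oddCount_cons (a : ℕ) (l : List ℕ) : oddCount (a :: l) = oddCount l + a % 2 := by
  rw [oddCount, List.countP_cons, oddCount]
  rcases Nat.mod_two_eq_zero_or_one a with h | h <;> simp [h]

theorem evenCount_cons (a : ℕ) (l : List ℕ) :
    evenCount (a :: l) = evenCount l + (1 - a % 2) := by
  rw [evenCount, List.countP_cons, evenCount]
  rcases Nat.mod_two_eq_zero_or_one a with h | h <;> simp [h]

theorem oddCount_add_evenCount (l : List ℕ) : oddCount l + evenCount l = l.length := by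
  induction l with
  | nil => rfl
  | cons a t ih => rw [oddCount_cons, evenCount_cons, List.length_cons]; omega

theorem parityRank_append_zero {l : List ℕ} (hl : Odd l.length) :
    parityRank (l ++ [0]) = parityRank l := by
  have hlen := Nat.odd_iff.1 hl
  simp only [parityRank, oddCount, evenCount, List.countP_append, List.length_append,
    List.countP_singleton, List.length_singleton, Nat.zero_mod, zero_ne_one, decide_true,
    decide_false, if_true, Bool.false_eq_true, if_false]
  omega

theorem parityRank_of_forall_even {l : List ℕ} (h : ∀ a ∈ l, a % 2 = 0) :
    parityRank l = l.length + l.length % 2 := by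
  have hodd : oddCount l = 0 := List.countP_eq_zero.2 fun a ha => by simp [h a ha]
  have := oddCount_add_evenCount l
  rw [parityRank]
  omega

section Erase

variable {x y : ℕ} {t : List ℕ}

theorem oddCount_cons_of_mem (hy : y ∈ t) :
    oddCount (x :: t) = oddCount (t.erase y) + y % 2 + x % 2 := by
  rw [oddCount_cons, oddCount, (List.perm_cons_erase hy).countP_eq, ← oddCount, oddCount_cons]

theorem evenCount_cons_of_mem (hy : y ∈ t) :
    evenCount (x :: t) = evenCount (t.erase y) + (1 - y % 2) + (1 - x % 2) := by
  rw [evenCount_cons, evenCount, (List.perm_cons_erase hy).countP_eq, ← evenCount,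
    evenCount_cons]

theorem length_cons_of_mem (hy : y ∈ t) : (x :: t).length = (t.erase y).length + 2 := by
  rw [List.length_cons, ← List.length_erase_add_one hy]

theorem parityRank_cons_le (hy : y ∈ t) :
    parityRank (x :: t) ≤ 2 - (x + y) % 2 + parityRank (t.erase y) := by
  rw [parityRank, parityRank, oddCount_cons_of_mem hy, evenCount_cons_of_mem hy,
    length_cons_of_mem hy]
  omega

theorem parityRank_cons_of_odd_add (hy : y ∈ t) (hxy : (x + y) % 2 = 1) :
    parityRank (x :: t) = 1 + parityRank (t.erase y) := by
  rw [parityRank, parityRank, oddCount_cons_of_mem hy, evenCount_cons_of_mem hy,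
    length_cons_of_mem hy]
  omega

end Erase

end ParityRank

section Padded

/-- The strictly decreasing lists of even length: strict partitions, padded with a zero if their
length is odd. -/
def IsPadded (l : List ℕ) : Prop := Even l.length ∧ l.Pairwise (· > ·)

namespace IsPadded

variable {x y : ℕ} {t : List ℕ}

theorem odd_length_tail (h : IsPadded (x :: t)) : Odd t.length := by
  have := h.1
  rwa [List.length_cons, Nat.even_add_one, Nat.not_even_iff_odd] at this

theorem lt_head (h : IsPadded (x :: t)) (hy : y ∈ t) : y < x :=
  (List.pairwise_cons.1 h.2).1 y hy

theorem nodup_tail (h : IsPadded (x :: t)) : t.Nodup :=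
  (List.pairwise_cons.1 h.2).2.imp ne_of_gt

theorem erase (h : IsPadded (x :: t)) (hy : y ∈ t) : IsPadded (t.erase y) := by
  refine ⟨?_, (List.pairwise_cons.1 h.2).2.sublist List.erase_sublist⟩
  rw [List.length_erase_of_mem hy]
  exact h.odd_length_tail.tsub_odd odd_one

theorem parityRank_of_odd_or_zero {l : List ℕ} (hl : IsPadded l)
    (h : ∀ a ∈ l, a = 0 ∨ a % 2 = 1) : parityRank l = oddCount l := by
  have heven : evenCount l = l.count 0 :=
    List.countP_congr fun a ha => by simpa using ⟨by have := h a ha; omega, by omega⟩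
  have hcount := List.nodup_iff_count_le_one.1 (hl.2.imp ne_of_gt) 0
  have hlength := oddCount_add_evenCount l
  have hmod := Nat.even_iff.1 hl.1
  rw [parityRank]
  omega

@[elab_as_elim]
theorem induction {motive : (l : List ℕ) → IsPadded l → Prop} (nil : motive [] ⟨by simp, by simp⟩)
    (cons : ∀ x t (h : IsPadded (x :: t)),
      (∀ y (hy : y ∈ t), motive (t.erase y) (h.erase hy)) → motive (x :: t) h)
    {l : List ℕ} (hl : IsPadded l) : motive l hl := by
  induction hn : l.length using Nat.strong_induction_on generalizing l with
  | _ n ih =>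
    cases l with
    | nil => exact nil
    | cons x t =>
      refine cons x t hl fun y hy => ih _ ?_ (hl.erase hy) rfl
      rw [← hn, length_cons_of_mem hy]
      omega

end IsPadded

end Padded

section TermLengths

open MvPolynomial

variable {x : ℕ} {t l : List ℕ} {m : ℕ+ →₀ ℕ}

theorem coeff_schurQPoly_cons (h : IsPadded (x :: t)) (m : ℕ+ →₀ ℕ) :
    coeff m (schurQPoly (x :: t)) =
      altSum (fun y r => coeff m (qTwoPoly x y * schurQPoly r)) t := by
  rw [schurQPoly_cons x h.odd_length_tail]
  exact map_altSum (lcoeff ℚ m) _ _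

theorem exists_add_of_coeff_mul_ne_zero {σ R : Type*} [CommSemiring R] {F G : MvPolynomial σ R}
    {m : σ →₀ ℕ} (h : coeff m (F * G) ≠ 0) :
    ∃ m₁ m₂, m₁ + m₂ = m ∧ coeff m₁ F ≠ 0 ∧ coeff m₂ G ≠ 0 := by
  classical
  rw [coeff_mul] at h
  obtain ⟨⟨m₁, m₂⟩, hm, hne⟩ := exists_ne_zero_of_sum_ne_zero h
  exact ⟨m₁, m₂, HasAntidiagonal.mem_antidiagonal.1 hm, left_ne_zero_of_mul hne,
    right_ne_zero_of_mul hne⟩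

theorem exists_add_of_coeff_schurQPoly_cons_ne_zero (h : IsPadded (x :: t))
    (hm : coeff m (schurQPoly (x :: t)) ≠ 0) : ∃ y ∈ t, ∃ m₁ m₂, m₁ + m₂ = m ∧
      coeff m₁ (qTwoPoly x y) ≠ 0 ∧ coeff m₂ (schurQPoly (t.erase y)) ≠ 0 := by
  rw [coeff_schurQPoly_cons h] at hm
  obtain ⟨y, hy, hne⟩ := exists_mem_of_altSum_ne_zero h.nodup_tail hm
  exact ⟨y, hy, exists_add_of_coeff_mul_ne_zero hne⟩

theorem parityRank_le_degree (hl : IsPadded l) (hm : coeff m (schurQPoly l) ≠ 0) :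
    parityRank l ≤ m.degree := by
  induction hl using IsPadded.induction generalizing m with
  | nil => exact Nat.zero_le _
  | cons x t hl ih =>
    obtain ⟨y, hy, m₁, m₂, rfl, hm₁, hm₂⟩ := exists_add_of_coeff_schurQPoly_cons_ne_zero hl hm
    have hlt := hl.lt_head hy
    calc parityRank (x :: t)
      _ ≤ 2 - (x + y) % 2 + parityRank (t.erase y) := parityRank_cons_le hy
      _ ≤ m₁.degree + m₂.degree :=
        add_le_add (le_degree_of_coeff_qTwoPoly_ne_zero (by omega) hm₁) (ih y hy hm₂)
      _ = (m₁ + m₂).degree := (map_add _ _ _).symm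

theorem degree_eq_of_degree_add_eq {y : ℕ} {m₁ m₂ : ℕ+ →₀ ℕ} (hl : IsPadded (x :: t))
    (hy : y ∈ t) (hm₁ : coeff m₁ (qTwoPoly x y) ≠ 0) (hm₂ : coeff m₂ (schurQPoly (t.erase y)) ≠ 0)
    (hdegree : (m₁ + m₂).degree = parityRank (x :: t)) :
    m₁.degree = 2 - (x + y) % 2 ∧ m₂.degree = parityRank (t.erase y) := by
  have hlt := hl.lt_head hy
  have hle₁ := le_degree_of_coeff_qTwoPoly_ne_zero (by omega) hm₁
  have hle₂ := parityRank_le_degree (hl.erase hy) hm₂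
  have hle := parityRank_cons_le (x := x) hy
  rw [map_add] at hdegree
  omega

theorem index_le_of_degree_eq_parityRank (hl : IsPadded l) (hm : coeff m (schurQPoly l) ≠ 0)
    (hdegree : m.degree = parityRank l) {k : ℕ+} (hk : k ∈ m.support) :
    (∃ a ∈ l, (k : ℕ) ≤ a) ∨ ∃ a ∈ l, ∃ b ∈ l, (a + b) % 2 = 1 ∧ (k : ℕ) ≤ a + b := by
  induction hl using IsPadded.induction generalizing m with
  | nil =>
    rw [(Finsupp.degree_eq_zero_iff m).1 hdegree] at hk
    simp at hk
  | cons x t hl ih =>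
    obtain ⟨y, hy, m₁, m₂, rfl, hm₁, hm₂⟩ := exists_add_of_coeff_schurQPoly_cons_ne_zero hl hm
    obtain ⟨hdegree₁, hdegree₂⟩ := degree_eq_of_degree_add_eq hl hy hm₁ hm₂ hdegree
    rcases mem_union.1 (Finsupp.support_add hk) with hk | hk
    · by_cases hxy : (x + y) % 2 = 1
      · exact .inr ⟨x, by simp, y, List.mem_cons_of_mem _ hy, hxy,
          le_add_of_coeff_qTwoPoly_ne_zero hm₁ hk⟩
      · exact .inl ⟨x, by simp,
          le_of_coeff_qTwoPoly_ne_zero (hl.lt_head hy) hm₁ (by omega) hk⟩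
    · have hsub {a : ℕ} (ha : a ∈ t.erase y) : a ∈ x :: t :=
        List.mem_cons_of_mem _ (List.mem_of_mem_erase ha)
      rcases ih y hy hm₂ hdegree₂ hk with ⟨a, ha, hka⟩ | ⟨a, ha, b, hb, hab, hkab⟩
      · exact .inl ⟨a, hsub ha, hka⟩
      · exact .inr ⟨a, hsub ha, b, hsub hb, hab, hkab⟩

theorem index_le_of_forall_even (hl : IsPadded l) (heven : ∀ a ∈ l, a % 2 = 0)
    (hm : coeff m (schurQPoly l) ≠ 0) (hdegree : m.degree = parityRank l) {k : ℕ+}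
    (hk : k ∈ m.support) : ∃ a ∈ l, (k : ℕ) ≤ a := by
  refine (index_le_of_degree_eq_parityRank hl hm hdegree hk).resolve_right ?_
  rintro ⟨a, ha, b, hb, hab, -⟩
  have := heven a ha
  have := heven b hb
  omega

end TermLengths

section LeastTerm

open MvPolynomial

variable {x c : ℕ} {t l : List ℕ} {e μ : ℕ+ →₀ ℕ}

theorem coeff_add_mul_of_unique {σ R : Type*} [CommSemiring R] {F G : MvPolynomial σ R}
    {a b : σ →₀ ℕ}
    (h : ∀ m₁ m₂, m₁ + m₂ = a + b → coeff m₁ F ≠ 0 → coeff m₂ G ≠ 0 → m₁ = a) :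
    coeff (a + b) (F * G) = coeff a F * coeff b G :=
  AddMonoidAlgebra.coeff_mul_add_of_uniqueAdd fun m₁ m₂ h₁ h₂ hadd => by
    obtain rfl := h m₁ m₂ hadd (mem_support_iff.1 h₁) (mem_support_iff.1 h₂)
    exact ⟨rfl, add_left_cancel hadd⟩

theorem le_left_of_add_eq_add {σ : Type*} {a b m₁ m₂ : σ →₀ ℕ} (hadd : m₁ + m₂ = a + b)
    (h : ∀ k ∈ a.support, k ∉ m₂.support) : a ≤ m₁ := by
  intro k
  have hk := DFunLike.congr_fun hadd k
  by_cases hka : k ∈ a.support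
  · simp only [Finsupp.add_apply, Finsupp.notMem_support_iff.1 (h k hka)] at hk
    omega
  · rw [Finsupp.notMem_support_iff.1 hka]
    exact Nat.zero_le _

theorem eq_of_le_of_degree_eq {σ : Type*} {a m : σ →₀ ℕ} (hle : a ≤ m)
    (h : a.degree = m.degree) : a = m := by
  obtain ⟨d, rfl⟩ := exists_add_of_le hle
  rw [map_add] at h
  rw [(Finsupp.degree_eq_zero_iff d).1 (by omega), add_zero]

theorem coeff_add_schurQPoly_cons_ne_zero (hl : IsPadded (x :: t)) (hc : c ∈ t)
    (he : coeff e (qTwoPoly x c) ≠ 0) (hμ : coeff μ (schurQPoly (t.erase c)) ≠ 0)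
    (hunique : ∀ y ∈ t, ∀ m₁ m₂, m₁ + m₂ = e + μ → coeff m₁ (qTwoPoly x y) ≠ 0 →
      coeff m₂ (schurQPoly (t.erase y)) ≠ 0 → y = c ∧ m₁ = e) :
    coeff (e + μ) (schurQPoly (x :: t)) ≠ 0 := by
  rw [coeff_schurQPoly_cons hl]
  refine altSum_ne_zero_of_unique hl.nodup_tail hc ?_ fun y hy hyc => ?_
  · rw [coeff_add_mul_of_unique fun m₁ m₂ hm h₁ h₂ => (hunique c hc m₁ m₂ hm h₁ h₂).2]
    exact mul_ne_zero he hμ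
  · by_contra hne
    obtain ⟨m₁, m₂, hm, h₁, h₂⟩ := exists_add_of_coeff_mul_ne_zero hne
    exact hyc (hunique y hy m₁ m₂ hm h₁ h₂).1

theorem coeff_single_qTwoPoly_ne_zero (hx : 0 < x) {k : ℕ+} (hk : (k : ℕ) = x + c)
    (hodd : Odd (k : ℕ)) : coeff (Finsupp.single k 1) (qTwoPoly x c) ≠ 0 := by
  rw [← linCoeff_eq_coeff, linCoeff_qTwoPoly hx hk hodd]
  exact mul_ne_zero (qTwoCoeff_ne_zero c) (by simp)

theorem coeff_single_add_single_qTwoPoly_ne_zero (hcx : c < x) {i j : ℕ+} (hi : (i : ℕ) + 1 = x)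
    (hj : (j : ℕ) = c + 1) (hji : j ≤ i) (hio : Odd (i : ℕ)) (hjo : Odd (j : ℕ)) :
    coeff (Finsupp.single j 1 + Finsupp.single i 1) (qTwoPoly x c) ≠ 0 := by
  have h : quadCoeff j i (qTwoPoly x c) ≠ 0 := by
    rw [quadCoeff_qTwoPoly hcx (by omega) hji hjo hio, if_neg (by omega), add_zero]
    exact mul_ne_zero (qTwoCoeff_ne_zero c) (by simp)
  rw [quadCoeff_eq_coeff] at h
  exact left_ne_zero_of_mul h

theorem coeff_ne_zero_of_max_opposite_parity (hl : IsPadded (x :: t)) (hc : c ∈ t) (hc0 : 0 < c)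
    (hxc : (x + c) % 2 = 1) (hmax : ∀ a ∈ t, (x + a) % 2 = 1 → a ≤ c) {k : ℕ+}
    (hk : (k : ℕ) = x + c) (hμ : coeff μ (schurQPoly (t.erase c)) ≠ 0)
    (hdegree : μ.degree = parityRank (t.erase c)) :
    coeff (Finsupp.single k 1 + μ) (schurQPoly (x :: t)) ≠ 0 := by
  refine coeff_add_schurQPoly_cons_ne_zero hl hc
    (coeff_single_qTwoPoly_ne_zero (Nat.zero_lt_of_lt (hl.lt_head hc)) hk
      (hk ▸ Nat.odd_iff.2 hxc)) hμ fun y hy m₁ m₂ hadd hm₁ hm₂ => ?_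
  have hyx := hl.lt_head hy
  obtain ⟨hdegree₁, hdegree₂⟩ := degree_eq_of_degree_add_eq hl hy hm₁ hm₂ (by
    rw [hadd, map_add, Finsupp.degree_single, hdegree, parityRank_cons_of_odd_add hc hxc])
  have hkm₂ : k ∉ m₂.support := by
    intro hkm
    have hlt {a : ℕ} (ha : a ∈ t.erase y) := hl.lt_head (List.mem_of_mem_erase ha)
    rcases index_le_of_degree_eq_parityRank (hl.erase hy) hm₂ hdegree₂ hkm with
      ⟨a, ha, hka⟩ | ⟨a, ha, b, hb, hab, hkab⟩
    · have := hlt ha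
      omega
    · have := hlt ha
      have := hlt hb
      have := hmax a (List.mem_of_mem_erase ha)
      have := hmax b (List.mem_of_mem_erase hb)
      omega
  have hle : Finsupp.single k 1 ≤ m₁ := le_left_of_add_eq_add hadd fun j hj => by
    rwa [mem_singleton.1 (Finsupp.support_single_subset hj)]
  have hkm₁ : k ∈ m₁.support := Finsupp.support_mono hle (by simp)
  have hkxy := le_add_of_coeff_qTwoPoly_ne_zero hm₁ hkm₁
  have hxy : (x + y) % 2 = 1 := by
    by_contra
    have := le_of_coeff_qTwoPoly_ne_zero hyx hm₁ (by omega) hkm₁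
    omega
  have hyc := hmax y hy hxy
  refine ⟨by omega, (eq_of_le_of_degree_eq hle ?_).symm⟩
  rw [Finsupp.degree_single, hdegree₁, hxy]

theorem coeff_ne_zero_of_forall_even (hl : IsPadded (x :: c :: t))
    (heven : ∀ a ∈ x :: c :: t, a % 2 = 0) {i j : ℕ+} (hi : (i : ℕ) + 1 = x)
    (hj : (j : ℕ) = c + 1) (hμ : coeff μ (schurQPoly t) ≠ 0) (hdegree : μ.degree = parityRank t) :
    coeff (Finsupp.single j 1 + Finsupp.single i 1 + μ) (schurQPoly (x :: c :: t)) ≠ 0 := by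
  have hx2 := heven x (by simp)
  have hc2 := heven c (by simp)
  have hcx := hl.lt_head (y := c) (by simp)
  have hle_c : ∀ a ∈ c :: t, a ≤ c := by
    simpa using fun a ha => ((List.pairwise_cons.1 (List.pairwise_cons.1 hl.2).2).1 a ha).le
  refine coeff_add_schurQPoly_cons_ne_zero hl List.mem_cons_self
    (coeff_single_add_single_qTwoPoly_ne_zero hcx hi hj (PNat.coe_le_coe _ _ |>.1 (by omega))
      (Nat.odd_iff.2 (by omega)) (Nat.odd_iff.2 (by omega)))
    (by rwa [List.erase_cons_head]) fun y hy m₁ m₂ hadd hm₁ hm₂ => ?_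
  have hy2 := heven y (List.mem_cons_of_mem _ hy)
  obtain ⟨hdegree₁, hdegree₂⟩ := degree_eq_of_degree_add_eq hl hy hm₁ hm₂ (by
    rw [hadd, map_add, map_add, Finsupp.degree_single, Finsupp.degree_single, hdegree,
      parityRank_of_forall_even heven, parityRank_of_forall_even fun a ha => heven a (by simp [ha])]
    simp only [List.length_cons]
    omega)
  have hle : Finsupp.single j 1 + Finsupp.single i 1 ≤ m₁ :=
    le_left_of_add_eq_add hadd fun k hk hkm => by
      have hck : c < k := by
        rcases mem_union.1 (Finsupp.support_add hk) with h | h <;>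
        · rw [mem_singleton.1 (Finsupp.support_single_subset h)]
          omega
      obtain ⟨a, ha, hka⟩ := index_le_of_forall_even (hl.erase hy)
        (fun a ha => heven a (List.mem_cons_of_mem _ (List.mem_of_mem_erase ha))) hm₂ hdegree₂ hkm
      exact (hka.trans (hle_c a (List.mem_of_mem_erase ha))).not_gt hck
  have hm₁e := eq_of_le_of_degree_eq hle (by
    rw [map_add, Finsupp.degree_single, Finsupp.degree_single, hdegree₁]
    omega)
  have hweight := weight_eq_of_coeff_qTwoPoly_ne_zero hm₁
  rw [← hm₁e, map_add, Finsupp.weight_single, Finsupp.weight_single] at hweight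
  exact ⟨by simp only [smul_eq_mul] at hweight; omega, hm₁e.symm⟩

/-- The exponent vector of `p_a`, with `p_0 = 1`. -/
def partExponent (a : ℕ) : ℕ+ →₀ ℕ := if h : 0 < a then Finsupp.single (a.toPNat h) 1 else 0

/-- The exponent vector of the product of the power sums indexed by the positive entries of `l`. -/
def partMonomial (l : List ℕ) : ℕ+ →₀ ℕ := (l.map partExponent).sum

/-- For odd `a`, the coefficient of `p_a` in `q_a`. -/
def partFactor (a : ℕ) : ℚ := if a = 0 then 1 else 2 / a

theorem partExponent_coe (k : ℕ+) : partExponent k = Finsupp.single k 1 := dif_pos k.pos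

theorem partFactor_coe (k : ℕ+) : partFactor k = 2 / (k : ℚ) := if_neg k.ne_zero

theorem partExponent_zero : partExponent 0 = 0 := rfl

theorem partFactor_ne_zero (a : ℕ) : partFactor a ≠ 0 := by
  rw [partFactor]
  split_ifs with h
  · exact one_ne_zero
  · positivity

theorem degree_partMonomial (h : ∀ a ∈ l, a = 0 ∨ a % 2 = 1) :
    (partMonomial l).degree = oddCount l := by
  induction l with
  | nil => rfl
  | cons a t ih =>
    rw [partMonomial, List.map_cons, List.sum_cons, map_add, ← partMonomial, oddCount_cons,
      ih fun b hb => h b (List.mem_cons_of_mem _ hb), add_comm]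
    rcases h a List.mem_cons_self with rfl | ha
    · rw [partExponent_zero, map_zero, Nat.zero_mod]
    · lift a to ℕ+ using (by omega)
      rw [partExponent_coe, Finsupp.degree_single, ha]

theorem partMonomial_cons_of_mem {y : ℕ} (hy : y ∈ t) :
    partMonomial (x :: t) = partExponent x + partExponent y + partMonomial (t.erase y) := by
  rw [partMonomial, List.map_cons, List.sum_cons, ← List.sum_map_erase _ hy, add_assoc]
  rfl

theorem eq_partExponent {y : ℕ} {m : ℕ+ →₀ ℕ} (hy : y = 0 ∨ y % 2 = 1)
    (hdegree : m.degree = y % 2) (hweight : Finsupp.weight (fun k : ℕ+ => (k : ℕ)) m = y) :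
    m = partExponent y := by
  rcases hy with rfl | hy
  · exact (Finsupp.degree_eq_zero_iff m).1 hdegree
  · obtain ⟨k, rfl⟩ := (Finsupp.sum_eq_one_iff m).1 (by change m.degree = 1; rw [hdegree, hy])
    rw [← hweight, Finsupp.weight_single, one_smul, partExponent_coe]

theorem coeff_partExponent_add_qTwoPoly {y : ℕ} (hyx : y < x) (hx : x % 2 = 1)
    (hy : y = 0 ∨ y % 2 = 1) : coeff (partExponent x + partExponent y) (qTwoPoly x y) =
      (-1) ^ (y % 2) * (partFactor x * partFactor y) := by
  lift x to ℕ+ using (by omega)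
  rcases hy with rfl | hy
  · rw [partExponent_zero, add_zero, partExponent_coe, ← linCoeff_eq_coeff,
      linCoeff_qTwoPoly x.pos (by simp) (Nat.odd_iff.2 hx), partFactor_coe]
    simp [qTwoCoeff, partFactor]
  · lift y to ℕ+ using (by omega)
    have hne : y ≠ x := fun h => hyx.ne (congrArg _ h)
    have h := quadCoeff_eq_coeff y x (qTwoPoly x y)
    rw [quadCoeff_qTwoPoly hyx (add_comm _ _) (PNat.coe_le_coe _ _ |>.1 hyx.le) (Nat.odd_iff.2 hy)
      (Nat.odd_iff.2 hx), if_pos le_rfl, Nat.sub_self, qTwoCoeff_of_odd (Nat.odd_iff.2 hy),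
      Finsupp.single_eq_of_ne hne.symm, add_comm (Finsupp.single y 1)] at h
    simp only [qTwoCoeff, if_true, zero_add, Nat.cast_one, mul_one] at h
    rw [partExponent_coe, partExponent_coe, ← h, partFactor_coe, partFactor_coe, hy]
    field_simp
    norm_num

theorem eq_partExponent_add_of_add_eq {y : ℕ} {m₁ m₂ : ℕ+ →₀ ℕ} (hl : IsPadded (x :: t))
    (h : ∀ a ∈ x :: t, a = 0 ∨ a % 2 = 1) (hy : y ∈ t) (hadd : m₁ + m₂ = partMonomial (x :: t))
    (hm₁ : coeff m₁ (qTwoPoly x y) ≠ 0) (hm₂ : coeff m₂ (schurQPoly (t.erase y)) ≠ 0) :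
    m₁ = partExponent x + partExponent y := by
  have hyx := hl.lt_head hy
  have hx := h x List.mem_cons_self
  have hy2 := h y (List.mem_cons_of_mem _ hy)
  obtain ⟨hdegree₁, hdegree₂⟩ := degree_eq_of_degree_add_eq hl hy hm₁ hm₂ (by
    rw [hadd, degree_partMonomial h, hl.parityRank_of_odd_or_zero h])
  have hweight := weight_eq_of_coeff_qTwoPoly_ne_zero hm₁
  lift x to ℕ+ using (by omega)
  rw [partMonomial_cons_of_mem hy, partExponent_coe, add_assoc] at hadd
  have hle : Finsupp.single x 1 ≤ m₁ := le_left_of_add_eq_add hadd fun k hk hkm => by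
    obtain rfl := mem_singleton.1 (Finsupp.support_single_subset hk)
    have hmem {a : ℕ} (ha : a ∈ t.erase y) : a ∈ t := List.mem_of_mem_erase ha
    rcases index_le_of_degree_eq_parityRank (hl.erase hy) hm₂ hdegree₂ hkm with
      ⟨a, ha, hka⟩ | ⟨a, ha, b, hb, hab, hkab⟩
    · exact (hl.lt_head (hmem ha)).not_ge hka
    · have := hl.lt_head (hmem ha)
      have := hl.lt_head (hmem hb)
      have := h a (List.mem_cons_of_mem _ (hmem ha))
      have := h b (List.mem_cons_of_mem _ (hmem hb))
      omega
  obtain ⟨n, rfl⟩ := exists_add_of_le hle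
  rw [map_add, Finsupp.degree_single] at hdegree₁
  rw [map_add, Finsupp.weight_single, one_smul] at hweight
  rw [partExponent_coe, eq_partExponent (m := n) hy2 (by omega) (by omega)]

theorem coeff_partMonomial_schurQPoly (hl : IsPadded l) (h : ∀ a ∈ l, a = 0 ∨ a % 2 = 1) :
    coeff (partMonomial l) (schurQPoly l) =
      (-1) ^ (l.length / 2 + evenCount l) * (l.map partFactor).prod := by
  induction hl using IsPadded.induction with
  | nil => simp [schurQPoly_nil, partMonomial, evenCount]
  | cons x t hl ih =>
    rw [coeff_schurQPoly_cons hl, ← altSum_const_of_odd (_ * _) hl.odd_length_tail]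
    refine altSum_congr_of_nodup hl.nodup_tail fun y hy => ?_
    have hyx := hl.lt_head hy
    have hx := h x List.mem_cons_self
    have hy2 := h y (List.mem_cons_of_mem _ hy)
    have hsign : (-1 : ℚ) ^ ((x :: t).length / 2 + evenCount (x :: t)) =
        (-1) ^ (y % 2) * (-1) ^ ((t.erase y).length / 2 + evenCount (t.erase y)) := by
      rw [← pow_add, length_cons_of_mem hy, evenCount_cons_of_mem hy]
      exact neg_one_pow_congr (by simp only [Nat.even_iff]; omega)
    rw [partMonomial_cons_of_mem hy, coeff_add_mul_of_unique fun m₁ m₂ hadd =>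
        eq_partExponent_add_of_add_eq hl h hy (by rw [hadd, partMonomial_cons_of_mem hy]),
      coeff_partExponent_add_qTwoPoly hyx (by omega) hy2,
      ih y hy fun a ha => h a (List.mem_cons_of_mem _ (List.mem_of_mem_erase ha)), hsign,
      List.map_cons, List.prod_cons, ← List.prod_map_erase _ hy]
    ring

theorem exists_max_opposite_parity (h : ∃ a ∈ t, 0 < a ∧ (x + a) % 2 = 1) :
    ∃ c ∈ t, 0 < c ∧ (x + c) % 2 = 1 ∧ ∀ a ∈ t, (x + a) % 2 = 1 → a ≤ c := by
  obtain ⟨c, hc, hmax⟩ := exists_max_image ({a ∈ t.toFinset | 0 < a ∧ (x + a) % 2 = 1}) id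
    (by simpa [Finset.Nonempty] using h)
  simp only [mem_filter, List.mem_toFinset, id] at hc hmax
  refine ⟨c, hc.1, hc.2.1, hc.2.2, fun a ha hxa => ?_⟩
  rcases a.eq_zero_or_pos with rfl | ha0
  · exact hc.2.1.le
  · exact hmax a ⟨ha, ha0, hxa⟩

theorem exists_degree_eq_parityRank (hl : IsPadded l) :
    ∃ m : ℕ+ →₀ ℕ, m.degree = parityRank l ∧ coeff m (schurQPoly l) ≠ 0 := by
  induction hl using IsPadded.induction with
  | nil => exact ⟨0, rfl, by simp [schurQPoly_nil]⟩
  | cons x t hl ih =>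
    by_cases hopp : ∃ a ∈ t, 0 < a ∧ (x + a) % 2 = 1
    · obtain ⟨c, hc, hc0, hxc, hmax⟩ := exists_max_opposite_parity hopp
      obtain ⟨μ, hdegree, hμ⟩ := ih c hc
      refine ⟨Finsupp.single ((x + c).toPNat (by omega)) 1 + μ, ?_,
        coeff_ne_zero_of_max_opposite_parity hl hc hc0 hxc hmax rfl hμ hdegree⟩
      rw [map_add, Finsupp.degree_single, hdegree, parityRank_cons_of_odd_add hc hxc]
    have hsame : ∀ a ∈ x :: t, a = 0 ∨ a % 2 = x % 2 := by
      push Not at hopp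
      simpa using fun a ha => by have := hopp a ha; omega
    rcases Nat.mod_two_eq_zero_or_one x with hx | hx <;> rw [hx] at hsame
    · have heven : ∀ a ∈ x :: t, a % 2 = 0 := fun a ha => by have := hsame a ha; omega
      cases t with
      | nil => exact absurd hl.odd_length_tail (by simp)
      | cons c r =>
        obtain ⟨μ, hdegree, hμ⟩ := ih c List.mem_cons_self
        rw [List.erase_cons_head] at hdegree hμ
        have hcx := hl.lt_head (y := c) List.mem_cons_self
        have hc := heven c (by simp)
        refine ⟨Finsupp.single c.succPNat 1 + Finsupp.single ((x - 1).toPNat (by omega)) 1 + μ, ?_,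
          coeff_ne_zero_of_forall_even hl heven (Nat.sub_add_cancel (by omega)) rfl hμ hdegree⟩
        rw [map_add, map_add, Finsupp.degree_single, Finsupp.degree_single, hdegree,
          parityRank_of_forall_even heven,
          parityRank_of_forall_even fun a ha => heven a (by simp [ha])]
        simp only [List.length_cons]
        omega
    · refine ⟨partMonomial (x :: t), ?_, ?_⟩
      · rw [degree_partMonomial hsame, hl.parityRank_of_odd_or_zero hsame]
      · rw [coeff_partMonomial_schurQPoly hl hsame]
        refine mul_ne_zero (pow_ne_zero _ (by norm_num)) (List.prod_ne_zero fun h0 => ?_)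
        obtain ⟨a, -, ha⟩ := List.mem_map.1 h0
        exact partFactor_ne_zero a ha

theorem isLeast_degree_schurQPoly {lam : List ℕ} (hstrict : lam.Pairwise (· > ·))
    (hpos : ∀ a ∈ lam, 0 < a) :
    IsLeast {d | ∃ m ∈ (schurQPoly lam).support, m.degree = d} (parityRank lam) := by
  have hpad : ∃ l, IsPadded l ∧ schurQPoly l = schurQPoly lam ∧ parityRank l = parityRank lam := by
    rcases Nat.even_or_odd lam.length with hlen | hlen
    · exact ⟨lam, ⟨hlen, hstrict⟩, rfl, rfl⟩
    · refine ⟨lam ++ [0], ⟨by simpa using hlen.add_one, ?_⟩, schurQPoly_append_zero hlen,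
        parityRank_append_zero hlen⟩
      exact List.pairwise_append.2 ⟨hstrict, by simp, by simpa using hpos⟩
  obtain ⟨l, hl, hpoly, hrank⟩ := hpad
  simp only [mem_support_iff, ← hpoly, ← hrank]
  constructor
  · obtain ⟨m, hdegree, hm⟩ := exists_degree_eq_parityRank hl
    exact ⟨m, hm, hdegree⟩
  · rintro d ⟨m, hm, rfl⟩
    exact parityRank_le_degree hl hm

end LeastTerm

section Rows

variable {lam : List ℕ} {i j : ℕ}

theorem mem_shiftedDiagram_iff_getD :
    (i, j) ∈ shiftedDiagram lam ↔ i ≤ j ∧ j < i + lam.getD i 0 := by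
  rw [mem_shiftedDiagram]
  by_cases hi : i < lam.length
  · simp [hi]
  · simp only [hi, IsEmpty.exists_iff, List.getD_eq_default _ _ (not_lt.1 hi), false_iff]
    omega

theorem getD_pos (hpos : ∀ a ∈ lam, 0 < a) (hi : i < lam.length) : 0 < lam.getD i 0 := by
  rw [List.getD_eq_getElem _ _ hi]
  exact hpos _ (List.getElem_mem hi)

theorem mem_shiftedDiagram_diag (hpos : ∀ a ∈ lam, 0 < a) (hi : i < lam.length) :
    (i, i) ∈ shiftedDiagram lam :=
  mem_shiftedDiagram_iff_getD.2 ⟨le_rfl, Nat.lt_add_of_pos_right (getD_pos hpos hi)⟩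

theorem filter_row_shiftedDiagram (p : ℕ × ℕ → Prop) [DecidablePred p] (i : ℕ) :
    {c ∈ shiftedDiagram lam | c.1 = i ∧ p c} =
      {j ∈ Ico i (i + lam.getD i 0) | p (i, j)}.image (Prod.mk i) := by
  ext ⟨i', j⟩
  simp only [mem_filter, mem_shiftedDiagram_iff_getD, mem_image, mem_Ico, Prod.mk.injEq]
  constructor
  · rintro ⟨hij, rfl, hp⟩
    exact ⟨j, ⟨hij, hp⟩, rfl, rfl⟩
  · rintro ⟨j, ⟨hij, hp⟩, rfl, rfl⟩
    exact ⟨hij, rfl, hp⟩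

theorem card_filter_row_shiftedDiagram (p : ℕ × ℕ → Prop) [DecidablePred p] (i : ℕ) :
    #{c ∈ shiftedDiagram lam | c.1 = i ∧ p c} = #{j ∈ Ico i (i + lam.getD i 0) | p (i, j)} := by
  rw [filter_row_shiftedDiagram, card_image_of_injective _ (Prod.mk_right_injective i)]

theorem card_row_shiftedDiagram (i : ℕ) : #{c ∈ shiftedDiagram lam | c.1 = i} = lam.getD i 0 := by
  simpa using card_filter_row_shiftedDiagram (lam := lam) (fun _ => True) i

theorem card_shiftedDiagram (lam : List ℕ) : #(shiftedDiagram lam) = lam.sum := by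
  rw [shiftedDiagram, card_biUnion fun i _ i' _ h => ?_]
  · simp
  · exact disjoint_product.2 (.inl (disjoint_singleton.2 (Fin.val_ne_of_ne h)))

theorem sum_mod_two (lam : List ℕ) : lam.sum % 2 = oddCount lam % 2 := by
  induction lam with
  | nil => rfl
  | cons a t ih =>
    rw [List.sum_cons, oddCount_cons]
    omega

theorem countP_eq_count (p : ℕ → Prop) [DecidablePred p] (l : List ℕ) :
    l.countP p = Nat.count (fun i => p (l.getD i 0)) l.length := by
  induction l with
  | nil => rfl
  | cons a t ih => simp [List.countP_cons, Nat.count_succ', ih]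

theorem oddCount_eq_card : oddCount lam = #{i ∈ range lam.length | lam.getD i 0 % 2 = 1} :=
  (countP_eq_count (· % 2 = 1) lam).trans (Nat.count_eq_card_filter_range _ _)

theorem evenCount_eq_card : evenCount lam = #{i ∈ range lam.length | lam.getD i 0 % 2 = 0} :=
  (countP_eq_count (· % 2 = 0) lam).trans (Nat.count_eq_card_filter_range _ _)

end Rows

namespace BarTableau

variable {lam : List ℕ} (T : BarTableau lam) {i i' k : ℕ}

/-- The number of squares with entry `k` in row `i`. -/
def rowCount (i k : ℕ) : ℕ := #{c ∈ shiftedDiagram lam | T.entry c = k ∧ c.1 = i}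

theorem sum_rowCount (i : ℕ) :
    ∑ k ∈ (shiftedDiagram lam).image T.entry, T.rowCount i k = lam.getD i 0 := by
  rw [← card_row_shiftedDiagram i, card_eq_sum_card_fiberwise (f := T.entry)
    (fun c hc => mem_image_of_mem _ (mem_filter.1 hc).1)]
  simp only [rowCount, filter_filter, and_comm]

theorem exists_of_rowCount_ne_zero (h : T.rowCount i k ≠ 0) :
    ∃ c ∈ shiftedDiagram lam, T.entry c = k ∧ c.1 = i := by
  obtain ⟨c, hc⟩ := card_ne_zero.1 h
  exact ⟨c, mem_filter.1 hc⟩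

theorem mem_image_of_rowCount_ne_zero (h : T.rowCount i k ≠ 0) :
    k ∈ (shiftedDiagram lam).image T.entry := by
  obtain ⟨c, hc, rfl, -⟩ := T.exists_of_rowCount_ne_zero h
  exact mem_image_of_mem _ hc

theorem odd_rowCount_add_rowCount (hi : T.rowCount i k ≠ 0) (hi' : T.rowCount i' k ≠ 0)
    (hne : i ≠ i') : Odd (T.rowCount i k + T.rowCount i' k) := by
  obtain ⟨c, hc, rfl, rfl⟩ := T.exists_of_rowCount_ne_zero hi
  obtain ⟨c', hc', hk, rfl⟩ := T.exists_of_rowCount_ne_zero hi'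
  have hrows : {c.1, c'.1} =
      ({d ∈ shiftedDiagram lam | T.entry d = T.entry c} : Finset _).image Prod.fst := by
    refine eq_of_subset_of_card_le (insert_subset_iff.2 ⟨?_, singleton_subset_iff.2 ?_⟩) ?_
    · exact mem_image_of_mem _ (mem_filter.2 ⟨hc, rfl⟩)
    · exact mem_image_of_mem _ (mem_filter.2 ⟨hc', hk⟩)
    · rw [card_pair hne]
      exact T.rows_le_two _ (T.entry_pos c hc)
  have hodd := T.odd_count c hc
  rwa [card_eq_sum_card_image Prod.fst, ← hrows, sum_pair hne, filter_filter, filter_filter]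
    at hodd

theorem entry_diag_eq (hi : T.rowCount i k ≠ 0) (hi' : T.rowCount i' k ≠ 0) (hne : i ≠ i') :
    T.entry (i, i) = k := by
  obtain ⟨c, hc, rfl, rfl⟩ := T.exists_of_rowCount_ne_zero hi
  obtain ⟨c', hc', hk, rfl⟩ := T.exists_of_rowCount_ne_zero hi'
  exact (T.begin_of_two_rows _ (T.entry_pos c hc) c hc c' hc' rfl hk hne).1

theorem oddCount_le_numBars : oddCount lam ≤ T.numBars := by
  rw [oddCount_eq_card]
  refine card_le_card_of_forall_subsingleton (fun i k => Odd (T.rowCount i k))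
    (fun i hi => ?_) fun k _ i hi i' hi' => ?_
  · have hodd : Odd (∑ k ∈ (shiftedDiagram lam).image T.entry, T.rowCount i k) := by
      rw [sum_rowCount]
      exact Nat.odd_iff.2 (mem_filter.1 hi).2
    obtain ⟨k, hk⟩ := card_pos.1 ((odd_sum_iff_odd_card_odd _).1 hodd).pos
    exact ⟨k, mem_filter.1 hk⟩
  · by_contra hne
    exact Nat.not_even_iff_odd.2 (T.odd_rowCount_add_rowCount hi.2.pos.ne' hi'.2.pos.ne' hne)
      (hi.2.add_odd hi'.2)

theorem exists_odd_rowCount_iff_ne_entry_diag (hi : (i, i) ∈ shiftedDiagram lam)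
    (heven : lam.getD i 0 % 2 = 0) :
    ∃ k, T.rowCount i k ≠ 0 ∧ (Odd (T.rowCount i k) ↔ k ≠ T.entry (i, i)) := by
  have hfirst : T.rowCount i (T.entry (i, i)) ≠ 0 :=
    card_ne_zero.2 ⟨(i, i), mem_filter.2 ⟨hi, rfl, rfl⟩⟩
  by_cases hodd : Odd (T.rowCount i (T.entry (i, i)))
  · have hsum := T.sum_rowCount i
    rw [← add_sum_erase _ _ (T.mem_image_of_rowCount_ne_zero hfirst)] at hsum
    have hrest : Odd (∑ k ∈ ((shiftedDiagram lam).image T.entry).erase (T.entry (i, i)),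
        T.rowCount i k) := by
      rw [Nat.odd_iff] at hodd ⊢
      omega
    obtain ⟨k, hk⟩ := card_pos.1 ((odd_sum_iff_odd_card_odd _).1 hrest).pos
    obtain ⟨hk, hkodd⟩ := mem_filter.1 hk
    exact ⟨k, hkodd.pos.ne', iff_of_true hkodd (mem_erase.1 hk).1⟩
  · exact ⟨T.entry (i, i), hfirst, iff_of_false hodd (not_not.2 rfl)⟩

theorem evenCount_le_numBars (hpos : ∀ a ∈ lam, 0 < a) : evenCount lam ≤ T.numBars := by
  rw [evenCount_eq_card]
  refine card_le_card_of_forall_subsingleton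
    (fun i k => T.rowCount i k ≠ 0 ∧ (Odd (T.rowCount i k) ↔ k ≠ T.entry (i, i)))
    (fun i hi => ?_) fun k _ i hi i' hi' => ?_
  · rw [mem_filter, mem_range] at hi
    obtain ⟨k, hk⟩ :=
      T.exists_odd_rowCount_iff_ne_entry_diag (mem_shiftedDiagram_diag hpos hi.1) hi.2
    exact ⟨k, T.mem_image_of_rowCount_ne_zero hk.1, hk⟩
  · obtain ⟨-, hi, hk⟩ := hi
    obtain ⟨-, hi', hk'⟩ := hi'
    by_contra hne
    rw [T.entry_diag_eq hi hi' hne] at hk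
    rw [T.entry_diag_eq hi' hi (Ne.symm hne)] at hk'
    have := Nat.odd_add.1 (T.odd_rowCount_add_rowCount hi hi' hne)
    simp only [ne_eq, not_true, iff_false, Nat.not_odd_iff_even] at hk hk'
    exact Nat.not_odd_iff_even.2 hk (this.2 hk')

theorem numBars_mod_two : T.numBars % 2 = oddCount lam % 2 := by
  have hall : ∀ k ∈ (shiftedDiagram lam).image T.entry,
      Odd #{c ∈ shiftedDiagram lam | T.entry c = k} := by
    intro k hk
    obtain ⟨c, hc, rfl⟩ := mem_image.1 hk
    exact T.odd_count c hc
  have hsum := odd_sum_iff_odd_card_odd (s := (shiftedDiagram lam).image T.entry)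
    fun k => #{c ∈ shiftedDiagram lam | T.entry c = k}
  rw [filter_true_of_mem hall, ← card_eq_sum_card_image, card_shiftedDiagram, Nat.odd_iff,
    Nat.odd_iff, sum_mod_two] at hsum
  rw [numBars]
  omega

theorem parityRank_le_numBars (hpos : ∀ a ∈ lam, 0 < a) : parityRank lam ≤ T.numBars := by
  have hodd := T.oddCount_le_numBars
  have heven := T.evenCount_le_numBars hpos
  have hmod := T.numBars_mod_two
  have hlength := oddCount_add_evenCount lam
  rw [parityRank]
  omega

end BarTableau

theorem exists_lt_and_count_eq {p : ℕ → Prop} [DecidablePred p] {n r : ℕ}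
    (hr : r < Nat.count p n) : ∃ i < n, p i ∧ Nat.count p i = r := by
  induction n with
  | zero => simp at hr
  | succ n ih =>
    rw [Nat.count_succ] at hr
    by_cases hlt : r < Nat.count p n
    · obtain ⟨i, hi, hip⟩ := ih hlt
      exact ⟨i, hi.trans n.lt_succ_self, hip⟩
    · split_ifs at hr with hn
      · exact ⟨n, n.lt_succ_self, hn, by omega⟩
      · omega

section MinimalTableau

variable {lam : List ℕ} {i j k : ℕ}

/-- The number of rows above row `i` whose length has the same parity. -/
def rowRank (lam : List ℕ) (i : ℕ) : ℕ :=
  Nat.count (fun j => lam.getD j 0 % 2 = lam.getD i 0 % 2) i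

theorem rowRank_eq_count {b : ℕ} (h : lam.getD i 0 % 2 = b) :
    rowRank lam i = Nat.count (fun j => lam.getD j 0 % 2 = b) i := by
  simp only [rowRank, h]

theorem rowRank_lt_oddCount (hi : i < lam.length) (h : lam.getD i 0 % 2 = 1) :
    rowRank lam i < oddCount lam := by
  rw [rowRank_eq_count h, oddCount, countP_eq_count]
  simpa using Nat.count_strict_mono (p := fun j => lam.getD j 0 % 2 = 1) h hi

theorem rowRank_lt_evenCount (hi : i < lam.length) (h : lam.getD i 0 % 2 = 0) :
    rowRank lam i < evenCount lam := by
  rw [rowRank_eq_count h, evenCount, countP_eq_count]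
  simpa using Nat.count_strict_mono (p := fun j => lam.getD j 0 % 2 = 0) h hi

theorem eq_of_rowRank_eq (h : lam.getD i 0 % 2 = lam.getD j 0 % 2)
    (hr : rowRank lam i = rowRank lam j) : i = j := by
  rw [rowRank_eq_count h, rowRank] at hr
  exact Nat.count_injective (p := fun l => lam.getD l 0 % 2 = lam.getD j 0 % 2) h rfl hr

theorem exists_odd_row_rowRank_eq {r : ℕ} (hr : r < oddCount lam) :
    ∃ i < lam.length, lam.getD i 0 % 2 = 1 ∧ rowRank lam i = r := by
  rw [oddCount, countP_eq_count] at hr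
  obtain ⟨i, hi, hodd, hrank⟩ := exists_lt_and_count_eq hr
  exact ⟨i, hi, hodd, (rowRank_eq_count hodd).trans hrank⟩

theorem exists_even_row_rowRank_eq {r : ℕ} (hr : r < evenCount lam) :
    ∃ i < lam.length, lam.getD i 0 % 2 = 0 ∧ rowRank lam i = r := by
  rw [evenCount, countP_eq_count] at hr
  obtain ⟨i, hi, heven, hrank⟩ := exists_lt_and_count_eq hr
  exact ⟨i, hi, heven, (rowRank_eq_count heven).trans hrank⟩

/-- The number of bars filling the surplus rows, the even rows of rank at least `oddCount lam`,
which have no odd row of the same rank as a partner. -/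
def surplus (lam : List ℕ) : ℕ := parityRank lam - oddCount lam

/-- The first entry of row `i` of the minimal bar tableau. Rows of equal rank below `oddCount lam`
form one bar, an odd row together with an even row if there is one. The surplus rows are taken in
consecutive pairs `(a, b)`: one bar consists of row `b` and the first square of row `a`, another
one of the rest of row `a`. -/
def firstEntry (lam : List ℕ) (i : ℕ) : ℕ :=
  if rowRank lam i < oddCount lam then surplus lam + rowRank lam i + 1
  else 2 * ((rowRank lam i - oddCount lam) / 2) + 1

/-- The entry of row `i` of the minimal bar tableau after its first square; it differs from the
first entry in the upper rows of the pairs of surplus rows. -/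
def restEntry (lam : List ℕ) (i : ℕ) : ℕ :=
  if rowRank lam i < oddCount lam then firstEntry lam i
  else firstEntry lam i + (1 - (rowRank lam i - oddCount lam) % 2)

/-- The rows with an odd number of squares in each of their bars: the odd rows and the upper rows
of the pairs of surplus rows. Every bar of the minimal bar tableau has exactly one such row. -/
def IsLeadingRow (lam : List ℕ) (i : ℕ) : Prop :=
  lam.getD i 0 % 2 = 1 ∨
    oddCount lam ≤ rowRank lam i ∧ (rowRank lam i - oddCount lam) % 2 = 0

theorem firstEntry_pos (lam : List ℕ) (i : ℕ) : 0 < firstEntry lam i := by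
  rw [firstEntry]
  split_ifs <;> omega

theorem firstEntry_le_restEntry (lam : List ℕ) (i : ℕ) : firstEntry lam i ≤ restEntry lam i := by
  rw [restEntry]
  split_ifs <;> omega

theorem lt_oddCount_or_surplus (hi : i < lam.length) :
    rowRank lam i < oddCount lam ∧ surplus lam < firstEntry lam i ∨
      oddCount lam ≤ rowRank lam i ∧ lam.getD i 0 % 2 = 0 ∧ restEntry lam i ≤ surplus lam := by
  have hodd := rowRank_lt_oddCount hi
  have heven := rowRank_lt_evenCount hi
  have hlength := oddCount_add_evenCount lam
  rw [restEntry, firstEntry, surplus, parityRank]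
  split_ifs <;> omega

theorem restEntry_le_parityRank (hi : i < lam.length) : restEntry lam i ≤ parityRank lam := by
  have hsurplus : surplus lam + oddCount lam = parityRank lam :=
    Nat.sub_add_cancel (le_max_left _ _)
  rcases lt_oddCount_or_surplus hi with ⟨hlt, -⟩ | ⟨-, -, hle⟩
  · rw [restEntry, firstEntry, if_pos hlt, if_pos hlt]
    omega
  · omega

theorem eq_of_firstEntry_eq (hi : i < lam.length) (hj : j < lam.length)
    (h : firstEntry lam i = firstEntry lam j) (hlead : IsLeadingRow lam i ↔ IsLeadingRow lam j) :
    i = j := by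
  suffices lam.getD i 0 % 2 = lam.getD j 0 % 2 ∧ rowRank lam i = rowRank lam j from
    eq_of_rowRank_eq this.1 this.2
  have hi := lt_oddCount_or_surplus hi
  have hj := lt_oddCount_or_surplus hj
  rw [IsLeadingRow, IsLeadingRow] at hlead
  rw [restEntry, firstEntry] at hi hj
  rw [firstEntry, firstEntry] at h
  split_ifs at h hi hj <;> omega

theorem firstEntry_eq_of_ne (hi : i < lam.length) (hj : j < lam.length) (hne : i ≠ j)
    (hik : firstEntry lam i = k ∨ restEntry lam i = k)
    (hjk : firstEntry lam j = k ∨ restEntry lam j = k) : firstEntry lam i = k := by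
  have hrank : rowRank lam i ≠ rowRank lam j ∨ lam.getD i 0 % 2 ≠ lam.getD j 0 % 2 := by
    by_contra! h
    exact hne (eq_of_rowRank_eq h.2 h.1)
  have hi := lt_oddCount_or_surplus hi
  have hj := lt_oddCount_or_surplus hj
  rw [restEntry, firstEntry] at *
  split_ifs at * <;> omega

theorem exists_isLeadingRow (hi : i < lam.length)
    (hik : firstEntry lam i = k ∨ restEntry lam i = k) :
    ∃ j < lam.length, IsLeadingRow lam j ∧ (firstEntry lam j = k ∨ restEntry lam j = k) := by
  by_cases hlead : IsLeadingRow lam i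
  · exact ⟨i, hi, hlead, hik⟩
  rw [IsLeadingRow] at hlead
  rcases lt_oddCount_or_surplus hi with ⟨hlt, -⟩ | ⟨hge, heven, -⟩
  · obtain ⟨j, hj, hodd, hrank⟩ := exists_odd_row_rowRank_eq hlt
    refine ⟨j, hj, .inl hodd, ?_⟩
    simp only [restEntry, firstEntry, hrank] at hik ⊢
    exact hik
  · obtain ⟨j, hj, -, hrank⟩ := exists_even_row_rowRank_eq (lam := lam)
      (r := rowRank lam i - 1) (by have := rowRank_lt_evenCount hi heven; omega)
    refine ⟨j, hj, .inr (by omega), ?_⟩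
    simp only [restEntry, firstEntry, hrank] at hik ⊢
    split_ifs at hik ⊢ <;> omega

/-- The entries of the minimal bar tableau, with `0` outside of the shifted diagram. -/
def minimalEntry (lam : List ℕ) (c : ℕ × ℕ) : ℕ :=
  if c ∈ shiftedDiagram lam then (if c.2 = c.1 then firstEntry lam c.1 else restEntry lam c.1)
  else 0

theorem minimalEntry_of_mem {c : ℕ × ℕ} (hc : c ∈ shiftedDiagram lam) :
    minimalEntry lam c = if c.2 = c.1 then firstEntry lam c.1 else restEntry lam c.1 :=
  if_pos hc

theorem minimalEntry_diag (h : (i, i) ∈ shiftedDiagram lam) :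
    minimalEntry lam (i, i) = firstEntry lam i := by
  rw [minimalEntry_of_mem h, if_pos rfl]

theorem fst_lt_length_of_mem {c : ℕ × ℕ} (hc : c ∈ shiftedDiagram lam) : c.1 < lam.length :=
  ((mem_shiftedDiagram lam c.1 c.2).1 hc).1

theorem firstEntry_eq_or_restEntry_eq {c : ℕ × ℕ} (hc : c ∈ shiftedDiagram lam) :
    firstEntry lam c.1 = minimalEntry lam c ∨ restEntry lam c.1 = minimalEntry lam c := by
  rw [minimalEntry_of_mem hc]
  split_ifs
  exacts [.inl rfl, .inr rfl]

theorem minimalEntry_pos {c : ℕ × ℕ} (hc : c ∈ shiftedDiagram lam) : 0 < minimalEntry lam c := by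
  have hpos := firstEntry_pos lam c.1
  have hle := firstEntry_le_restEntry lam c.1
  have := firstEntry_eq_or_restEntry_eq hc
  omega

theorem minimalEntry_le_parityRank {c : ℕ × ℕ} (hc : c ∈ shiftedDiagram lam) :
    minimalEntry lam c ≤ parityRank lam := by
  have hle := firstEntry_le_restEntry lam c.1
  have hrest := restEntry_le_parityRank (fst_lt_length_of_mem hc)
  have := firstEntry_eq_or_restEntry_eq hc
  omega

theorem minimalEntry_mono_row {j₁ j₂ : ℕ} (hj : j₁ ≤ j₂) (h₁ : (i, j₁) ∈ shiftedDiagram lam)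
    (h₂ : (i, j₂) ∈ shiftedDiagram lam) : minimalEntry lam (i, j₁) ≤ minimalEntry lam (i, j₂) := by
  have hle := firstEntry_le_restEntry lam i
  have hij := (mem_shiftedDiagram_iff_getD.1 h₁).1
  rw [minimalEntry_of_mem h₁, minimalEntry_of_mem h₂]
  dsimp only
  split_ifs <;> omega

theorem card_row_minimalEntry (q : ℕ → Prop) [DecidablePred q] (hi : 0 < lam.getD i 0) :
    #{c ∈ shiftedDiagram lam | c.1 = i ∧ q (minimalEntry lam c)} =
      (if q (firstEntry lam i) then 1 else 0) +
        if q (restEntry lam i) then lam.getD i 0 - 1 else 0 := by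
  have hmem {j : ℕ} (hj : j ∈ Ico i (i + lam.getD i 0)) : (i, j) ∈ shiftedDiagram lam :=
    mem_shiftedDiagram_iff_getD.2 (mem_Ico.1 hj)
  have hdiag : i ∈ Ico i (i + lam.getD i 0) := mem_Ico.2 ⟨le_rfl, by omega⟩
  have hrest : ∀ j ∈ (Ico i (i + lam.getD i 0)).erase i,
      (if q (minimalEntry lam (i, j)) then 1 else 0) = if q (restEntry lam i) then 1 else 0 := by
    intro j hj
    rw [minimalEntry_of_mem (hmem (mem_of_mem_erase hj)), if_neg (ne_of_mem_erase hj)]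
  rw [card_filter_row_shiftedDiagram (fun c => q (minimalEntry lam c)), card_filter,
    ← add_sum_erase _ _ hdiag, minimalEntry_diag (hmem hdiag), sum_congr rfl hrest, sum_const,
    card_erase_of_mem hdiag, Nat.card_Ico, Nat.add_sub_cancel_left, smul_eq_mul, mul_ite, mul_one,
    mul_zero]

theorem odd_card_row_minimalEntry_iff (hpos : ∀ a ∈ lam, 0 < a) (hi : i < lam.length) (k : ℕ) :
    Odd #{c ∈ shiftedDiagram lam | c.1 = i ∧ minimalEntry lam c = k} ↔
      IsLeadingRow lam i ∧ (firstEntry lam i = k ∨ restEntry lam i = k) := by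
  have hrow := lt_oddCount_or_surplus hi
  have hlen := getD_pos hpos hi
  rw [card_row_minimalEntry (· = k) hlen, Nat.odd_iff, IsLeadingRow]
  rw [restEntry] at hrow ⊢
  grind

theorem odd_card_minimalEntry (hpos : ∀ a ∈ lam, 0 < a) {c : ℕ × ℕ}
    (hc : c ∈ shiftedDiagram lam) :
    Odd #{c' ∈ shiftedDiagram lam | minimalEntry lam c' = minimalEntry lam c} := by
  obtain ⟨i, hi, hlead, hik⟩ :=
    exists_isLeadingRow (fst_lt_length_of_mem hc) (firstEntry_eq_or_restEntry_eq hc)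
  suffices h : {j ∈ range lam.length | Odd #{c' ∈ shiftedDiagram lam |
      c'.1 = j ∧ minimalEntry lam c' = minimalEntry lam c}} = {i} by
    rw [card_eq_sum_card_fiberwise (f := Prod.fst) (t := range lam.length)
      fun c' hc' => mem_coe.2 (mem_range.2 (fst_lt_length_of_mem (mem_filter.1 hc').1))]
    simp only [filter_filter, and_comm]
    rw [odd_sum_iff_odd_card_odd, h, card_singleton]
    exact odd_one
  ext j
  rw [mem_filter, mem_range, mem_singleton]
  constructor
  · rintro ⟨hj, hodd⟩
    obtain ⟨hlead', hjk⟩ := (odd_card_row_minimalEntry_iff hpos hj _).1 hodd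
    by_contra hne
    refine hne (eq_of_firstEntry_eq hj hi ?_ (iff_of_true hlead' hlead))
    rw [firstEntry_eq_of_ne hj hi hne hjk hik, firstEntry_eq_of_ne hi hj (Ne.symm hne) hik hjk]
  · rintro rfl
    exact ⟨hi, (odd_card_row_minimalEntry_iff hpos hi _).2 ⟨hlead, hik⟩⟩

theorem card_rows_minimalEntry_le_two (lam : List ℕ) (k : ℕ) :
    #({c ∈ shiftedDiagram lam | minimalEntry lam c = k}.image Prod.fst) ≤ 2 := by
  classical
  refine (card_le_card_of_injOn (fun i => decide (IsLeadingRow lam i)) (fun i _ => mem_univ _)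
    fun i hi j hj hlead => ?_).trans Fintype.card_bool.le
  obtain ⟨c, hc, rfl⟩ := mem_image.1 hi
  obtain ⟨c', hc', rfl⟩ := mem_image.1 hj
  replace ⟨hc, rfl⟩ := mem_filter.1 hc
  replace ⟨hc', hk⟩ := mem_filter.1 hc'
  have hik := firstEntry_eq_or_restEntry_eq hc
  have hjk := hk ▸ firstEntry_eq_or_restEntry_eq hc'
  have hi := fst_lt_length_of_mem hc
  have hj := fst_lt_length_of_mem hc'
  by_contra hne
  refine hne (eq_of_firstEntry_eq hi hj ?_ (decide_eq_decide.1 hlead))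
  rw [firstEntry_eq_of_ne hi hj hne hik hjk, firstEntry_eq_of_ne hj hi (Ne.symm hne) hjk hik]

theorem minimalEntry_diag_eq_of_ne (hpos : ∀ a ∈ lam, 0 < a) {c c' : ℕ × ℕ}
    (hc : c ∈ shiftedDiagram lam) (hc' : c' ∈ shiftedDiagram lam)
    (h : minimalEntry lam c = minimalEntry lam c') (hne : c.1 ≠ c'.1) :
    minimalEntry lam (c.1, c.1) = minimalEntry lam c := by
  have hi := fst_lt_length_of_mem hc
  rw [minimalEntry_diag (mem_shiftedDiagram_diag hpos hi)]
  exact firstEntry_eq_of_ne hi (fst_lt_length_of_mem hc') hne (firstEntry_eq_or_restEntry_eq hc)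
    (h ▸ firstEntry_eq_or_restEntry_eq hc')

theorem row_minimalEntry_le_cases (hpos : ∀ a ∈ lam, 0 < a) {n : ℕ}
    (hcard : #{c ∈ shiftedDiagram lam | c.1 = i ∧ minimalEntry lam c ≤ k} = n) (hn : n ≠ 0) :
    i < lam.length ∧ (n = lam.getD i 0 ∧ firstEntry lam i ≤ k ∨
      n = 1 ∧ firstEntry lam i = k ∧ k < surplus lam ∧ IsLeadingRow lam i) := by
  have hi : i < lam.length := by
    obtain ⟨c, hc⟩ := card_ne_zero.1 (hcard ▸ hn)
    obtain ⟨hmem, rfl, -⟩ := mem_filter.1 hc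
    exact fst_lt_length_of_mem hmem
  have hrow := lt_oddCount_or_surplus hi
  have hlen := getD_pos hpos hi
  refine ⟨hi, ?_⟩
  rw [card_row_minimalEntry (· ≤ k) hlen] at hcard
  rw [restEntry] at hcard hrow
  rw [IsLeadingRow]
  split_ifs at hcard hrow <;> omega

theorem card_row_minimalEntry_le_ne (hstrict : lam.Pairwise (· > ·)) (hpos : ∀ a ∈ lam, 0 < a)
    (k : ℕ) (hne : i ≠ j)
    (h₀ : #{c ∈ shiftedDiagram lam | c.1 = i ∧ minimalEntry lam c ≤ k} ≠ 0) :
    #{c ∈ shiftedDiagram lam | c.1 = i ∧ minimalEntry lam c ≤ k} ≠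
      #{c ∈ shiftedDiagram lam | c.1 = j ∧ minimalEntry lam c ≤ k} := by
  intro heq
  obtain ⟨hi, hicases⟩ := row_minimalEntry_le_cases hpos rfl h₀
  obtain ⟨hj, hjcases⟩ := row_minimalEntry_le_cases hpos heq.symm h₀
  have hlen : lam.getD i 0 ≠ lam.getD j 0 := by
    have hnodup : lam.Nodup := hstrict.imp fun h => ne_of_gt h
    rw [List.getD_eq_getElem _ _ hi, List.getD_eq_getElem _ _ hj]
    exact fun h => hne (hnodup.getElem_inj_iff.1 h)
  have hirow := lt_oddCount_or_surplus hi
  have hjrow := lt_oddCount_or_surplus hj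
  rcases hicases with ⟨hi₁, hile⟩ | ⟨hi₁, hik, hks, hilead⟩ <;>
    rcases hjcases with ⟨hj₁, hjle⟩ | ⟨hj₁, hjk, hks, hjlead⟩
  · exact hlen (hi₁.symm.trans hj₁)
  · omega
  · omega
  · exact hne (eq_of_firstEntry_eq hi hj (hik.trans hjk.symm) (iff_of_true hilead hjlead))

/-- A bar tableau with `parityRank lam` bars. -/
def minimalBarTableau (hstrict : lam.Pairwise (· > ·)) (hpos : ∀ a ∈ lam, 0 < a) :
    BarTableau lam where
  entry := minimalEntry lam
  entry_pos _ := minimalEntry_pos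
  entry_eq_zero _ hc := if_neg hc
  row_weak _ _ _ := minimalEntry_mono_row
  odd_count _ := odd_card_minimalEntry hpos
  rows_le_two k _ := card_rows_minimalEntry_le_two lam k
  begin_of_two_rows := by
    rintro k - c hc c' hc' rfl h hne
    exact ⟨minimalEntry_diag_eq_of_ne hpos hc hc' h.symm hne,
      (minimalEntry_diag_eq_of_ne hpos hc' hc h hne.symm).trans h⟩
  distinct_rows k _ _ := card_row_minimalEntry_le_ne hstrict hpos k

theorem numBars_minimalBarTableau_le (hstrict : lam.Pairwise (· > ·)) (hpos : ∀ a ∈ lam, 0 < a) :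
    (minimalBarTableau hstrict hpos).numBars ≤ parityRank lam := by
  have hsub : (shiftedDiagram lam).image (minimalEntry lam) ⊆ Icc 1 (parityRank lam) :=
    image_subset_iff.2 fun _ hc => mem_Icc.2 ⟨minimalEntry_pos hc, minimalEntry_le_parityRank hc⟩
  exact (card_le_card hsub).trans_eq (by simp)

theorem srank_eq_parityRank (hstrict : lam.Pairwise (· > ·)) (hpos : ∀ a ∈ lam, 0 < a) :
    srank lam = parityRank lam := by
  refine le_antisymm ((Nat.sInf_le ?_).trans (numBars_minimalBarTableau_le hstrict hpos))
    (le_csInf ⟨_, minimalBarTableau hstrict hpos, rfl⟩ ?_)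
  · exact ⟨_, rfl⟩
  · rintro b ⟨T, rfl⟩
    exact T.parityRank_le_numBars hpos

end MinimalTableau

end

theorem mainTheorem1 (lam : List ℕ) (hstrict : lam.Pairwise (· > ·))
    (hpos : ∀ a ∈ lam, 0 < a) :
    (∃! F : MvPolynomial ℕ+ ℚ, IsPowerSumExpansion F (schurQ lam)) ∧
    ∀ F : MvPolynomial ℕ+ ℚ, IsPowerSumExpansion F (schurQ lam) →
      IsLeast {d : ℕ | ∃ m ∈ F.support, m.degree = d} (srank lam) := by
  simp only [isPowerSumExpansion_schurQ_iff]
  refine ⟨⟨_, rfl, fun _ h => h⟩, ?_⟩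
  rintro F rfl
  rw [srank_eq_parityRank hstrict hpos]
  exact isLeast_degree_schurQPoly hstrict hpos
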